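/- Let $n_{\mathrm R},n_{\mathrm T},K$ be nonnegative integers with $K<n_{\mathrm T}$, let $\mathbf H$ be an arbitrary complex $n_{\mathrm R}\times n_{\mathrm T}$ matrix and $N_0>0$. Let $\mathbf y=\mathbf H\mathbf x+\mathbf n$, where $\mathbf x\sim\mathcal{CN}(0,\mathbf I_{n_{\mathrm T}})$ and $\mathbf n\sim\mathcal{CN}(0,N_0\mathbf I_{n_{\mathrm R}})$ are independent circularly-symmetric complex Gaussian vectors. For a complex $n_{\mathrm T}\times n_{\mathrm R}$ matrix $\mathbf H_{\mathrm r}$ and a Hermitian $n_{\mathrm T}\times n_{\mathrm T}$ matrix $\mathbf G_{\mathrm r}$ of memory $K$ (its $(k,\ell)$ entry is $0$ whenever $|k-\ell|>K$) put $$\tilde T(\mathbf y|\mathbf x)=\exp\left(2\,\mathrm{Re}\{\mathbf x^{\mathrm H}\mathbf H_{\mathrm r}\mathbf y\}-\mathbf x^{\mathrm H}\mathbf G_{\mathrm r}\mathbf x\right),\qquad \tilde T(\mathbf y)=\int\tilde T(\mathbf y|\mathbf x)\,p_{\mathbf X}(\mathbf x)\,d\mathbf x\in(0,\infty],$$ $$I_{\mathrm{GMI}}(\mathbf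 H_{\mathrm r},\mathbf G_{\mathrm r})=-\mathbb E[\log\tilde T(\mathbf y)]+\mathbb E[\log\tilde T(\mathbf y|\mathbf x)]\in[-\infty,\infty),$$ the expectations being over the true joint law of $(\mathbf x,\mathbf y)$. For an $N\times N$ matrix $\mathbf C$ let $\mathbf C^i_j$ be its principal submatrix on rows and columns $i,\dots,j$, and let $\mathcal P^i_j[\mathbf X]$ be the $N\times N$ matrix whose principal submatrix on rows and columns $i,\dots,j$ is $\mathbf X$ and whose other entries are $0$ (for $j<i$ the block is empty and $\mathcal P^i_j$ is the zero matrix). For $0\le L<N$, an invertible matrix $\mathbf R$ is the $L$-band extension of $\mathbf C$ if the inverses below exist and $$\mathbf R^{-1}=\sum_{n=1}^{N-L}\mathcal P^n_{n+L}\left[(\mathbf C^n_{n+L})^{-1}\right]-\sum_{n=2}^{N-L}\mathcal P^n_{n+L-1}\left[(\mathbf C^n_{n+L-1})^{-1}\right].$$ (i) For every Hermitian $\mathbf G_{\mathrm r}$ of memory $K$, the matrix $$\mathbf H_{\mathrm r}^{\mathrm{opt}}=\mathbf H_{\mathrm r}^{\mathrm{opt}}(\mathbf G_{\mathrm r})=(\mathbf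 I_{n_{\mathrm T}}+\mathbf G_{\mathrm r})\mathbf H^{\mathrm H}\left[\mathbf H\mathbf H^{\mathrm H}+N_0\mathbf I_{n_{\mathrm R}}\right]^{-1}$$ maximizes $I_{\mathrm{GMI}}(\cdot,\mathbf G_{\mathrm r})$ over all complex $n_{\mathrm T}\times n_{\mathrm R}$ matrices. It is the only maximizer if $\mathbf I_{n_{\mathrm T}}+\mathbf G_{\mathrm r}$ is positive definite; otherwise $I_{\mathrm{GMI}}(\mathbf H_{\mathrm r},\mathbf G_{\mathrm r})=-\infty$ for all $\mathbf H_{\mathrm r}$. (ii) The function $\mathbf G_{\mathrm r}\mapsto I_{\mathrm{GMI}}(\mathbf H_{\mathrm r}^{\mathrm{opt}}(\mathbf G_{\mathrm r}),\mathbf G_{\mathrm r})$ on the Hermitian matrices of memory $K$ has exactly one maximizer $\mathbf G_{\mathrm r}^{\mathrm{opt}}$. The matrix $\mathbf I_{n_{\mathrm T}}+\mathbf G_{\mathrm r}^{\mathrm{opt}}$ is invertible, and $(\mathbf I_{n_{\mathrm T}}+\mathbf G_{\mathrm r}^{\mathrm{opt}})^{-1}$ is the $K$-band extension of the MMSE matrix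 $$\mathbf B=\mathbf I_{n_{\mathrm T}}-\mathbf H^{\mathrm H}\left(\mathbf H\mathbf H^{\mathrm H}+N_0\mathbf I_{n_{\mathrm R}}\right)^{-1}\mathbf H.$$ In other words, $$\mathbf I_{n_{\mathrm T}}+\mathbf G_{\mathrm r}^{\mathrm{opt}}=\sum_{n=1}^{n_{\mathrm T}-K}\mathcal P^n_{n+K}\left[(\mathbf B^n_{n+K})^{-1}\right]-\sum_{n=2}^{n_{\mathrm T}-K}\mathcal P^n_{n+K-1}\left[(\mathbf B^n_{n+K-1})^{-1}\right].$$ -/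

import Mathlib

open MeasureTheory ProbabilityTheory
open scoped Matrix ENNReal ComplexOrder

namespace ChannelShortening

noncomputable section

/-! ### Gaussian vectors and the channel -/

/-- The law `CN(0, v)` of a zero-mean circularly-symmetric complex Gaussian variable with
`E|z|² = v`: independent real and imaginary parts, each `N(0, v / 2)`. -/
def complexGaussian (v : ℝ) : Measure ℂ :=
  ((gaussianReal 0 (v / 2).toNNReal).prod (gaussianReal 0 (v / 2).toNNReal)).map
    Complex.measurableEquivRealProd.symm

/-- The law `CN(0, v I_n)` on `ℂⁿ`. -/
def complexGaussianVec (n : ℕ) (v : ℝ) : Measure (Fin n → ℂ) :=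
  Measure.pi fun _ => complexGaussian v

/-- The joint law of the input `x ∼ CN(0, I)` and the output `y = H x + w` of the channel, where the
noise `w ∼ CN(0, N₀ I)` is independent of `x`. -/
def channelLaw {nR nT : ℕ} (H : Matrix (Fin nR) (Fin nT) ℂ) (N₀ : ℝ) :
    Measure ((Fin nT → ℂ) × (Fin nR → ℂ)) :=
  ((complexGaussianVec nT 1).prod (complexGaussianVec nR N₀)).map
    fun p => (p.1, H *ᵥ p.1 + p.2)

/-! ### The mismatched receiver function and the generalized mutual information -/

/-- The receiver function `T(y|x) = exp(2 Re(xᴴ Hr y) - xᴴ Gr x)`; the form `xᴴ Gr x` is real since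
`Gr` is Hermitian in all uses. -/
def receiverFun {nR nT : ℕ} (Hr : Matrix (Fin nT) (Fin nR) ℂ) (Gr : Matrix (Fin nT) (Fin nT) ℂ)
    (x : Fin nT → ℂ) (y : Fin nR → ℂ) : ℝ :=
  Real.exp (2 * (star x ⬝ᵥ (Hr *ᵥ y)).re - (star x ⬝ᵥ (Gr *ᵥ x)).re)

/-- `T(y) = ∫ T(y|x) p_X(x) dx ∈ [0, ∞]`. -/
def receiverMarginal {nR nT : ℕ} (Hr : Matrix (Fin nT) (Fin nR) ℂ)
    (Gr : Matrix (Fin nT) (Fin nT) ℂ) (y : Fin nR → ℂ) : ℝ≥0∞ :=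
  ∫⁻ x, ENNReal.ofReal (receiverFun Hr Gr x y) ∂complexGaussianVec nT 1

/-- The expectation of an extended-real function, `E[f⁺] - E[f⁻]`. -/
def extExpectation {Ω : Type*} [MeasurableSpace Ω] (μ : Measure Ω) (f : Ω → EReal) : EReal :=
  ((∫⁻ ω, (f ω).toENNReal ∂μ : ℝ≥0∞) : EReal) - ((∫⁻ ω, (-f ω).toENNReal ∂μ : ℝ≥0∞) : EReal)

/-- The generalized mutual information, in nats, `-E[log T(y)] + E[log T(y|x)]`, the expectations
being over the true channel law. Its value is `-∞` where `E[log T(y)] = ∞`. -/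
def gmi {nR nT : ℕ} (H : Matrix (Fin nR) (Fin nT) ℂ) (N₀ : ℝ)
    (Hr : Matrix (Fin nT) (Fin nR) ℂ) (Gr : Matrix (Fin nT) (Fin nT) ℂ) : EReal :=
  -extExpectation (channelLaw H N₀) (fun p => ENNReal.log (receiverMarginal Hr Gr p.2)) +
    extExpectation (channelLaw H N₀) (fun p => ((Real.log (receiverFun Hr Gr p.1 p.2) : ℝ) : EReal))

/-! ### Banded matrices and band extensions -/

/-- Only the center `2 K + 1` diagonals of `A` can be nonzero. -/
def IsBanded {N : ℕ} (K : ℕ) (A : Matrix (Fin N) (Fin N) ℂ) : Prop :=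
  ∀ k l : Fin N, (K : ℤ) < |(k : ℤ) - (l : ℤ)| → A k l = 0

/-- The positions `i, …, j` in one-based counting; empty if `j < i`. -/
def window (N i j : ℕ) : Finset (Fin N) :=
  Finset.univ.filter fun k => i ≤ (k : ℕ) + 1 ∧ (k : ℕ) + 1 ≤ j

/-- The principal submatrix of `C` spanning rows and columns `i` through `j`. -/
def principalBlock {N : ℕ} (C : Matrix (Fin N) (Fin N) ℂ) (i j : ℕ) :
    Matrix (window N i j) (window N i j) ℂ :=
  C.submatrix Subtype.val Subtype.val

/-- The `N × N` matrix whose principal submatrix spanning rows and columns `i` through `j` is `X`,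
and whose other entries are zero. -/
def placeBlock {N : ℕ} (i j : ℕ) (X : Matrix (window N i j) (window N i j) ℂ) :
    Matrix (Fin N) (Fin N) ℂ :=
  fun k l => if h : k ∈ window N i j ∧ l ∈ window N i j then X ⟨k, h.1⟩ ⟨l, h.2⟩ else 0

/-- The sum of the inverses of the `(L+1) × (L+1)` principal submatrices of `C` on consecutive
indices minus the sum of the inverses of the `L × L` overlaps of neighbouring ones, all put back in
place. -/
def bandSum {N : ℕ} (L : ℕ) (C : Matrix (Fin N) (Fin N) ℂ) : Matrix (Fin N) (Fin N) ℂ :=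
  (∑ n ∈ Finset.Icc 1 (N - L), placeBlock n (n + L) (principalBlock C n (n + L))⁻¹) -
    (∑ n ∈ Finset.Icc 2 (N - L), placeBlock n (n + L - 1) (principalBlock C n (n + L - 1))⁻¹)

/-- `R` is the `L`-band extension of `C`: all inverses in the formula exist, and `R⁻¹` is given by
the formula. -/
structure IsBandExtension {N : ℕ} (L : ℕ) (C R : Matrix (Fin N) (Fin N) ℂ) : Prop where
  isUnit_block : ∀ n ∈ Finset.Icc 1 (N - L), IsUnit (principalBlock C n (n + L))
  isUnit_overlap : ∀ n ∈ Finset.Icc 2 (N - L), IsUnit (principalBlock C n (n + L - 1))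
  isUnit : IsUnit R
  inv_eq : R⁻¹ = bandSum L C

/-! ### The matrices of the result -/

/-- `(I + Gr) Hᴴ (H Hᴴ + N₀ I)⁻¹`. -/
def optHr {nR nT : ℕ} (H : Matrix (Fin nR) (Fin nT) ℂ) (N₀ : ℝ) (Gr : Matrix (Fin nT) (Fin nT) ℂ) :
    Matrix (Fin nT) (Fin nR) ℂ :=
  (1 + Gr) * Hᴴ * (H * Hᴴ + (N₀ : ℂ) • (1 : Matrix (Fin nR) (Fin nR) ℂ))⁻¹

/-- The MMSE matrix `B = I - Hᴴ (H Hᴴ + N₀ I)⁻¹ H`. -/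
def mmseMatrix {nR nT : ℕ} (H : Matrix (Fin nR) (Fin nT) ℂ) (N₀ : ℝ) :
    Matrix (Fin nT) (Fin nT) ℂ :=
  1 - Hᴴ * (H * Hᴴ + (N₀ : ℂ) • (1 : Matrix (Fin nR) (Fin nR) ℂ))⁻¹ * H

end

end ChannelShortening

open ChannelShortening

/-! Gaussianity reduces everything to matrices. Put A = I + Gr. Rotating x into an eigenbasis of A
splits the integral defining T(y) into scalar Gaussian integrals. If A has a nonpositive eigenvalue,
T(y) is infinite for every y (`receiverMarginal_eq_top`); otherwise log T(y) is the quadratic form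
of A⁻¹ at Hr y minus log det A (`log_receiverMarginal`). The expectations then involve only second
moments of the channel and give `rate` (`gmi_eq_rate`). Completing the square in Hr (`rate_eq`)
exhibits `optHr` as the unique best front end and leaves log det A - tr(B A) + nT, with B the MMSE
matrix.

It remains to maximize this over banded A. Suppose S is positive definite and banded, and S⁻¹ agrees
with B on the band. Then tr(B A) = tr(S⁻¹ A) for every banded A (`trace_mul_eq_of_isBanded`), and
log det A - tr(S⁻¹ A) has its only maximum at A = S (`PosDef.log_det_sub_trace_le`).

The matrix S = `bandSum K B` has these properties. Deleting the first index of a window changes the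
inverse of the corresponding block of B by a rank-one term (`PosDef.blockInv_insert`), so the
alternating sum telescopes to S = U D⁻¹ Uᴴ, where U is lower triangular of bandwidth K and D is its
positive diagonal (`bandSum_eq_sum_blockInv`). Positivity and bandedness are visible from this.
Moreover S⁻¹ U and B U both agree with the identity on the lower band, so (S⁻¹ - B) U vanishes
there, and a backward induction gives S⁻¹ = B on the band (`inv_bandSum_apply`). -/

open ChannelShortening
open Matrix

/-! ### Inverses of principal blocks and rank-one updates -/

namespace Matrix

variable {ι : Type*}

/-- The principal submatrix of `B` on `s`. -/
abbrev principal (B : Matrix ι ι ℂ) (s : Finset ι) : Matrix s s ℂ :=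
  B.submatrix Subtype.val Subtype.val

lemma PosDef.principal {B : Matrix ι ι ℂ} (hB : B.PosDef) (s : Finset ι) :
    (B.principal s).PosDef :=
  hB.submatrix Subtype.val_injective

lemma submatrix_mul_of_support [Fintype ι] (B X : Matrix ι ι ℂ) {s : Finset ι}
    (hX : ∀ k, k ∉ s → ∀ l, X k l = 0) (k l : s) :
    ((B.principal s *
      X.principal s : Matrix s s ℂ)) k l = (B * X) k l := by
  simp only [mul_apply, submatrix_apply]
  rw [← Finset.sum_subset (Finset.subset_univ s)
    (f := fun j => B k j * X j l) (fun j _ hj => by rw [hX j hj, mul_zero])]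
  exact Finset.sum_coe_sort s (fun j => B k j * X j l)

variable [DecidableEq ι]

/-- The inverse of the principal submatrix of `B` on `s`, extended by zero. -/
noncomputable def blockInv (B : Matrix ι ι ℂ) (s : Finset ι) : Matrix ι ι ℂ :=
  fun k l => if h : k ∈ s ∧ l ∈ s then
    (B.principal s)⁻¹ ⟨k, h.1⟩ ⟨l, h.2⟩ else 0

lemma blockInv_apply_of_mem (B : Matrix ι ι ℂ) {s : Finset ι} (k l : s) :
    blockInv B s k l = (B.principal s)⁻¹ k l := by
  simp [blockInv]

lemma blockInv_apply_left (B : Matrix ι ι ℂ) {s : Finset ι} {k : ι} (hk : k ∉ s) (l : ι) :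
    blockInv B s k l = 0 := by
  simp [blockInv, hk]

lemma blockInv_apply_right (B : Matrix ι ι ℂ) {s : Finset ι} {l : ι} (hl : l ∉ s) (k : ι) :
    blockInv B s k l = 0 := by
  simp [blockInv, hl]

lemma PosDef.star_blockInv {B : Matrix ι ι ℂ} (hB : B.PosDef) (s : Finset ι) (k l : ι) :
    star (blockInv B s k l) = blockInv B s l k := by
  by_cases hk : k ∈ s
  · by_cases hl : l ∈ s
    · rw [blockInv_apply_of_mem B (⟨k, hk⟩ : s) ⟨l, hl⟩, blockInv_apply_of_mem B (⟨l, hl⟩ : s) ⟨k, hk⟩]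
      exact (hB.principal s).inv.1.apply _ _
    · simp [blockInv_apply_right B hl, blockInv_apply_left B hl]
  · simp [blockInv_apply_right B hk, blockInv_apply_left B hk]

lemma PosDef.blockInv_diag_pos {B : Matrix ι ι ℂ} (hB : B.PosDef) {s : Finset ι} {a : ι}
    (ha : a ∈ s) : 0 < blockInv B s a a := by
  rw [blockInv_apply_of_mem B (⟨a, ha⟩ : s) ⟨a, ha⟩]
  exact (hB.principal s).inv.diag_pos

variable [Fintype ι]

lemma PosDef.mul_blockInv {B : Matrix ι ι ℂ} (hB : B.PosDef) {s : Finset ι} {k l : ι}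
    (hk : k ∈ s) (hl : l ∈ s) : (B * blockInv B s) k l = (1 : Matrix ι ι ℂ) k l := by
  have h := submatrix_mul_of_support B (blockInv B s)
    (fun k hk l => blockInv_apply_left B hk l) (⟨k, hk⟩ : s) ⟨l, hl⟩
  rw [← h]
  have h2 : (blockInv B s).principal s
      = (B.principal s)⁻¹ := by
    ext i j; exact blockInv_apply_of_mem B i j
  rw [h2, mul_nonsing_inv _ ((isUnit_iff_isUnit_det _).1 (hB.principal s).isUnit)]
  simp [one_apply]

/-- For X supported on s × s, the entries of B X on s are computed by the principal blocks alone, so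
the third condition says that the block of X is a right inverse of the block of B. -/
lemma PosDef.eq_blockInv {B : Matrix ι ι ℂ} {s : Finset ι} {X : Matrix ι ι ℂ}
    (h1 : ∀ k, k ∉ s → ∀ l, X k l = 0) (h2 : ∀ l, l ∉ s → ∀ k, X k l = 0)
    (h3 : ∀ k ∈ s, ∀ l ∈ s, (B * X) k l = (1 : Matrix ι ι ℂ) k l) : X = blockInv B s := by
  have h : (B.principal s)⁻¹ =
      X.principal s := by
    apply inv_eq_right_inv
    ext i j
    rw [submatrix_mul_of_support B X h1, h3 _ i.2 _ j.2]
    simp [one_apply]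
  ext k l
  by_cases hk : k ∈ s
  · by_cases hl : l ∈ s
    · rw [blockInv_apply_of_mem B (⟨k, hk⟩ : s) ⟨l, hl⟩, h]; rfl
    · rw [h2 l hl, blockInv_apply_right B hl]
  · rw [h1 k hk, blockInv_apply_left B hk]

/-- A Schur complement. Eliminating with the pivot Q a a clears row and column a of Q. On t the
product with B is unaffected, because the subtracted term contributes a multiple of (B Q) k a, which
is zero for k in t. What remains is therefore the inverse of the smaller block. -/
lemma PosDef.blockInv_insert {B : Matrix ι ι ℂ} (hB : B.PosDef) {a : ι} {t : Finset ι}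
    (ha : a ∉ t) (k l : ι) :
    blockInv B (insert a t) k l - blockInv B t k l =
      blockInv B (insert a t) k a * (blockInv B (insert a t) a a)⁻¹ *
        star (blockInv B (insert a t) l a) := by
  set Q := blockInv B (insert a t) with hQ
  have hpos : 0 < Q a a := hB.blockInv_diag_pos (Finset.mem_insert_self a t)
  have hne : Q a a ≠ 0 := hpos.ne'
  have hst : ∀ i j, star (Q i j) = Q j i := hB.star_blockInv _
  have key : (Q - of fun k l => Q k a * (Q a a)⁻¹ * Q a l) = blockInv B t := by
    apply PosDef.eq_blockInv
    · intro k hk l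
      by_cases hka : k = a
      · subst hka; simp [hne]
      · have : k ∉ insert a t := by simp [hka, hk]
        simp [hQ, blockInv_apply_left B this]
    · intro l hl k
      by_cases hla : l = a
      · subst hla; simp [hne]
      · have : l ∉ insert a t := by simp [hla, hl]
        simp [hQ, blockInv_apply_right B this]
    · intro k hk l hl
      have h1 : (B * Q) k l = (1 : Matrix ι ι ℂ) k l :=
        hB.mul_blockInv (Finset.mem_insert_of_mem hk) (Finset.mem_insert_of_mem hl)
      have h2 : (B * Q) k a = (1 : Matrix ι ι ℂ) k a :=
        hB.mul_blockInv (Finset.mem_insert_of_mem hk) (Finset.mem_insert_self a t)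
      have hka : k ≠ a := fun h => ha (h ▸ hk)
      rw [mul_sub, Matrix.sub_apply, h1]
      have h3 : (B * of fun k l => Q k a * (Q a a)⁻¹ * Q a l : Matrix ι ι ℂ) k l =
          (B * Q) k a * ((Q a a)⁻¹ * Q a l) := by
        simp only [mul_apply, Finset.sum_mul, of_apply]
        exact Finset.sum_congr rfl fun j _ => by ring
      rw [h3, h2, one_apply_ne hka, zero_mul, sub_zero]
  rw [← key, hst]
  simp

end Matrix


/-! ### Triangular factorization of the band sum and its inverse on the band -/

namespace ChannelShortening

variable {N : ℕ}

/-- The window of length at most `K + 1` that starts at `a`. -/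
def windowFrom (K : ℕ) (a : Fin N) : Finset (Fin N) := window N (a + 1) (a + 1 + K)

lemma mem_windowFrom {K : ℕ} {a k : Fin N} :
    k ∈ windowFrom K a ↔ (a : ℕ) ≤ k ∧ (k : ℕ) ≤ a + K := by
  simp only [windowFrom, window, Finset.mem_filter, Finset.mem_univ, true_and]
  omega

/-- The unnormalised lower triangular factor of `bandSum K B`. -/
noncomputable def bandFactor (K : ℕ) (B : Matrix (Fin N) (Fin N) ℂ) : Matrix (Fin N) (Fin N) ℂ :=
  fun k a => blockInv B (windowFrom K a) k a

lemma sum_Icc_one_eq_sum_fin {M : Type*} [AddCommMonoid M] (f : ℕ → M) :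
    ∑ n ∈ Finset.Icc 1 N, f n = ∑ a : Fin N, f (a + 1) := by
  rw [Fin.sum_univ_eq_sum_range (fun a => f (a + 1)), Finset.range_eq_Ico,
    Finset.sum_Ico_add' f 0 N 1]
  rfl

lemma blockInv_empty (B : Matrix (Fin N) (Fin N) ℂ) {s : Finset (Fin N)} (hs : s = ∅) :
    blockInv B s = 0 := by
  ext k l
  exact blockInv_apply_left B (by simp [hs]) l

/-- Gives every index its own window, those near the end being truncated at N. The last full block
is unpaired in the definition; it equals the telescoping sum over the truncated windows, so the sum
becomes uniform in n. -/
lemma bandSum_eq_sum_sub {K : ℕ} (hK : K < N) (B : Matrix (Fin N) (Fin N) ℂ) :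
    bandSum K B = ∑ n ∈ Finset.Icc 1 N,
      (blockInv B (window N n (n + K)) - blockInv B (window N (n + 1) (n + K))) := by
  have hw : ∀ i j j', N ≤ j → N ≤ j' → window N i j = window N i j' := by
    intro i j j' h h'
    ext k
    simp only [window, Finset.mem_filter, Finset.mem_univ, true_and]
    omega
  have tail : ∀ m, m ≤ N → N ≤ m + K → blockInv B (window N m (m + K)) =
      ∑ n ∈ Finset.Icc m N,
        (blockInv B (window N n (n + K)) - blockInv B (window N (n + 1) (n + K))) := by
    intro m hm
    induction hm using Nat.decreasingInduction with
    | self =>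
      intro _
      rw [Finset.Icc_self, Finset.sum_singleton, blockInv_empty B (s := window N (N + 1) (N + K)),
        sub_zero]
      ext k
      simp only [window, Finset.mem_filter, Finset.mem_univ, true_and, Finset.notMem_empty,
        iff_false]
      omega
    | of_succ m hm ih =>
      -- The windows from m on reach the end of the index range, so extending the right endpoint by
      -- one changes nothing and consecutive terms cancel.
      intro h
      rw [← Finset.sum_Ioc_add_eq_sum_Icc (by omega : m ≤ N), ← Finset.Icc_add_one_left_eq_Ioc,
        ← ih (by omega), hw (m + 1) (m + 1 + K) (m + K) (by omega) h]
      abel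
  obtain ⟨d, hd⟩ : ∃ d, N - K = d + 1 := ⟨N - K - 1, by omega⟩
  have h1 : bandSum K B = (∑ n ∈ Finset.Icc 1 (d + 1), blockInv B (window N n (n + K))) -
      ∑ n ∈ Finset.Icc 2 (d + 1), blockInv B (window N n (n + K - 1)) := by
    rw [← hd]; rfl
  have h2 : ∑ n ∈ Finset.Icc 2 (d + 1), blockInv B (window N n (n + K - 1)) =
      ∑ n ∈ Finset.Icc 1 d, blockInv B (window N (n + 1) (n + K)) := by
    have : Finset.Icc 2 (d + 1) = Finset.map (addRightEmbedding 1) (Finset.Icc 1 d) := by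
      rw [Finset.map_add_right_Icc]
    rw [this, Finset.sum_map]
    refine Finset.sum_congr rfl fun n _ => ?_
    simp only [addRightEmbedding_apply]
    congr 2
    omega
  have h3 : Finset.Icc 1 N = Finset.Icc 1 d ∪ Finset.Icc (d + 1) N := by
    ext x; simp only [Finset.mem_Icc, Finset.mem_union]; omega
  have h4 : Disjoint (Finset.Icc 1 d) (Finset.Icc (d + 1) N) := by
    rw [Finset.disjoint_left]; intro x; simp only [Finset.mem_Icc]; omega
  rw [h1, h2, h3, Finset.sum_union h4, ← tail (d + 1) (by omega) (by omega),
    Finset.sum_Icc_succ_top (by omega), Finset.sum_sub_distrib]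
  abel

/-- Each difference removes the first index of a window, hence is the rank-one term of
`PosDef.blockInv_insert`; its vector is column a of the factor. -/
lemma bandSum_eq_sum_blockInv {K : ℕ} (hK : K < N) {B : Matrix (Fin N) (Fin N) ℂ}
    (hB : B.PosDef) : bandSum K B =
      bandFactor K B * diagonal (fun a => (bandFactor K B a a)⁻¹) * (bandFactor K B)ᴴ := by
  rw [bandSum_eq_sum_sub hK, sum_Icc_one_eq_sum_fin]
  ext k l
  rw [Matrix.sum_apply, mul_apply]
  refine Finset.sum_congr rfl fun a _ => ?_
  have h : window N (a + 1) (a + 1 + K) = insert a (window N (a + 1 + 1) (a + 1 + K)) := by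
    ext k
    simp only [window, Finset.mem_filter, Finset.mem_univ, true_and, Finset.mem_insert, Fin.ext_iff]
    omega
  have ha : a ∉ window N (a + 1 + 1) (a + 1 + K) := by
    simp only [window, Finset.mem_filter, Finset.mem_univ, true_and]
    omega
  have := hB.blockInv_insert ha k l
  rw [← h] at this
  rw [Matrix.sub_apply, this, mul_diagonal, conjTranspose_apply]
  rfl

section

variable {K : ℕ} {B : Matrix (Fin N) (Fin N) ℂ}

lemma bandFactor_eq_zero {k a : Fin N} (h : ¬((a : ℕ) ≤ k ∧ (k : ℕ) ≤ a + K)) :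
    bandFactor K B k a = 0 :=
  blockInv_apply_left B (fun h' => h (mem_windowFrom.1 h')) a

lemma bandFactor_diag_pos (hB : B.PosDef) (a : Fin N) : 0 < bandFactor K B a a :=
  hB.blockInv_diag_pos (mem_windowFrom.2 (by omega))

lemma mul_bandFactor (hB : B.PosDef) {k a : Fin N} (h : (a : ℕ) ≤ k ∧ (k : ℕ) ≤ a + K) :
    (B * bandFactor K B) k a = (1 : Matrix (Fin N) (Fin N) ℂ) k a :=
  hB.mul_blockInv (mem_windowFrom.2 h) (mem_windowFrom.2 (by omega))

lemma isUnit_bandFactor (hB : B.PosDef) : IsUnit (bandFactor K B) := by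
  rw [isUnit_iff_isUnit_det, isUnit_iff_ne_zero, det_of_isLowerTriangular]
  · exact Finset.prod_ne_zero_iff.2 fun a _ => (bandFactor_diag_pos hB a).ne'
  · intro k a h
    exact bandFactor_eq_zero (fun h' => by
      have : k < a := h
      have := Fin.lt_def.1 this
      omega)

lemma bandSum_posDef (hK : K < N) (hB : B.PosDef) : (bandSum K B).PosDef := by
  rw [bandSum_eq_sum_blockInv hK hB]
  refine ((isUnit_bandFactor hB).posDef_star_right_conjugate_iff).2 ?_
  rw [posDef_diagonal_iff]
  exact fun a => inv_pos.2 (bandFactor_diag_pos hB a)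

lemma bandSum_isBanded (hK : K < N) (hB : B.PosDef) : IsBanded K (bandSum K B) := by
  intro k l h
  rw [bandSum_eq_sum_blockInv hK hB, mul_apply]
  refine Finset.sum_eq_zero fun a _ => ?_
  rw [mul_diagonal, conjTranspose_apply]
  by_cases hk : (a : ℕ) ≤ k ∧ (k : ℕ) ≤ a + K
  · have : ¬((a : ℕ) ≤ l ∧ (l : ℕ) ≤ a + K) := by
      intro hl
      rw [lt_abs] at h
      omega
    simp [bandFactor_eq_zero this]
  · simp [bandFactor_eq_zero hk]

/-- `(bandSum K B)⁻¹` times the lower triangular factor is upper triangular with unit diagonal. -/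
lemma inv_bandSum_mul_bandFactor (hK : K < N) (hB : B.PosDef) {k a : Fin N} (h : a ≤ k) :
    ((bandSum K B)⁻¹ * bandFactor K B) k a = (1 : Matrix (Fin N) (Fin N) ℂ) k a := by
  set U := bandFactor K B with hU
  set V := (bandSum K B)⁻¹ * U with hV
  have hUu : IsUnit U := isUnit_bandFactor hB
  have hpos : ∀ a, 0 < U a a := bandFactor_diag_pos hB
  have hne : ∀ a, U a a ≠ 0 := fun a => (hpos a).ne'
  -- From S V = U and S = U D⁻¹ Uᴴ, cancelling the invertible U on the left gives D⁻¹ Uᴴ V = 1.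
  have hUV : Uᴴ * V = diagonal (fun a => U a a) := by
    have h1 : bandSum K B * V = U := by
      rw [hV, ← Matrix.mul_assoc, mul_nonsing_inv, Matrix.one_mul]
      exact (isUnit_iff_isUnit_det _).1 (bandSum_posDef hK hB).isUnit
    rw [bandSum_eq_sum_blockInv hK hB, ← hU, Matrix.mul_assoc, Matrix.mul_assoc] at h1
    have h2 : diagonal (fun a => (U a a)⁻¹) * (Uᴴ * V) = 1 := by
      apply hUu.mul_left_cancel
      rw [h1, mul_one]
    have h3 : diagonal (fun a => U a a) * (diagonal (fun a => (U a a)⁻¹) * (Uᴴ * V)) =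
        diagonal (fun a => U a a) := by rw [h2, Matrix.mul_one]
    rw [← Matrix.mul_assoc, diagonal_mul_diagonal] at h3
    simpa [hne] using h3
  have hlow : ∀ k a, k < a → U k a = 0 := by
    intro k a h
    exact bandFactor_eq_zero (fun h' => by have := Fin.lt_def.1 h; omega)
  have row : ∀ k a, ∑ j, star (U j k) * V j a = diagonal (fun a => U a a) k a := by
    intro k a
    rw [← hUV, mul_apply]; rfl
  -- Back substitution in the upper triangular system Uᴴ V = D, starting from the last row.
  have hupper : ∀ k a, a < k → V k a = 0 := by
    intro k
    induction k using WellFoundedGT.induction with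
    | ind k ih =>
      intro a hak
      have h1 := row k a
      rw [diagonal_apply_ne _ hak.ne', Finset.sum_eq_single k] at h1
      · exact (mul_eq_zero.1 h1).resolve_left (star_ne_zero.2 (hne k))
      · intro j _ hj
        rcases lt_or_gt_of_ne hj with hj | hj
        · rw [hlow j k hj]; simp
        · rw [ih j hj a (hak.trans hj), mul_zero]
      · simp
  rcases h.lt_or_eq with h | rfl
  · rw [hupper k a h, one_apply_ne h.ne']
  · have h1 := row a a
    rw [diagonal_apply_eq, Finset.sum_eq_single a] at h1
    · have : star (U a a) = U a a := hB.star_blockInv _ _ _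
      rw [this] at h1
      rw [one_apply_eq]
      exact mul_left_cancel₀ (hne a) (by rw [h1, mul_one])
    · intro j _ hj
      rcases lt_or_gt_of_ne hj with hj | hj
      · rw [hlow j a hj]; simp
      · rw [hupper j a hj, mul_zero]
    · simp

/-- The inverse of `bandSum K B` extends the band of `B`. -/
lemma inv_bandSum_apply (hK : K < N) (hB : B.PosDef) {k l : Fin N}
    (h : |(k : ℤ) - (l : ℤ)| ≤ K) : (bandSum K B)⁻¹ k l = B k l := by
  set E := (bandSum K B)⁻¹ - B with hE
  have hEst : ∀ i j, star (E i j) = E j i :=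
    fun i j => ((bandSum_posDef hK hB).inv.1.sub hB.1).apply j i
  have hst0 : ∀ i j, E i j = 0 → E j i = 0 := fun i j h => by rw [← hEst, h, star_zero]
  -- On the lower band both S⁻¹ U and B U have the entries of the identity, the first by
  -- triangularity and the second because column a of U is a column of a block inverse.
  have hEU : ∀ k a : Fin N, (a : ℕ) ≤ k → (k : ℕ) ≤ a + K →
      ∑ j, E k j * bandFactor K B j a = 0 := by
    intro k a h1 h2
    rw [← mul_apply, hE, Matrix.sub_mul, Matrix.sub_apply,
      inv_bandSum_mul_bandFactor hK hB (Fin.le_def.2 h1), mul_bandFactor hB ⟨h1, h2⟩, sub_self]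
  -- Columns are treated from last to first. Column a of U lives on a, …, a + K with nonzero entry
  -- at a, so E k a vanishes once E k j does for the later j in that window.
  have main : ∀ a k : Fin N, (a : ℕ) ≤ k → (k : ℕ) ≤ a + K → E k a = 0 := by
    intro a
    induction a using WellFoundedGT.induction with
    | ind a ih =>
      have key : ∀ k : Fin N, (a : ℕ) ≤ k → (k : ℕ) ≤ a + K →
          (∀ j : Fin N, (a : ℕ) < j → (j : ℕ) ≤ a + K → E k j = 0) → E k a = 0 := by
        intro k h1 h2 h3
        have h4 := hEU k a h1 h2
        rw [Finset.sum_eq_single a] at h4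
        · exact (mul_eq_zero.1 h4).resolve_right (bandFactor_diag_pos hB a).ne'
        · intro j _ hj
          by_cases h5 : (a : ℕ) ≤ j ∧ (j : ℕ) ≤ a + K
          · have : (j : ℕ) ≠ a := fun h => hj (Fin.ext h)
            rw [h3 j (by omega) h5.2, zero_mul]
          · rw [bandFactor_eq_zero h5, mul_zero]
        · simp
      -- Below the diagonal the entries needed lie in later columns, up to Hermitian symmetry. The
      -- diagonal entry needs row a itself, which is the conjugate of what is proved here, so it
      -- comes last.
      have off : ∀ k : Fin N, (a : ℕ) < k → (k : ℕ) ≤ a + K → E k a = 0 := by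
        intro k h1 h2
        refine key k h1.le h2 fun j h3 h4 => ?_
        rcases le_total (j : ℕ) k with h5 | h5
        · exact ih j (Fin.lt_def.2 h3) k h5 (by omega)
        · exact hst0 _ _ (ih k (Fin.lt_def.2 h1) j h5 (by omega))
      intro k h1 h2
      rcases h1.lt_or_eq with h3 | h3
      · exact off k h3 h2
      · have : k = a := Fin.ext h3.symm
        subst this
        exact key k h1 h2 fun j h4 h5 => hst0 _ _ (off j h4 h5)
  have : E k l = 0 := by
    rw [abs_le] at h
    rcases le_total (l : ℕ) k with h1 | h1
    · exact main l k h1 (by omega)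
    · exact hst0 _ _ (main k l h1 (by omega))
  rwa [hE, Matrix.sub_apply, sub_eq_zero] at this

end

end ChannelShortening

namespace ChannelShortening

/-! ### Exponential-quadratic Gaussian integrals -/

lemma gaussianReal_half_eq_withDensity :
    gaussianReal 0 ((1 : ℝ) / 2).toNNReal = volume.withDensity
      (fun t => ENNReal.ofReal ((√Real.pi)⁻¹ * Real.exp (-t ^ 2))) := by
  rw [gaussianReal_of_var_ne_zero _ (by simp)]
  congr 1
  ext t
  rw [gaussianPDF, gaussianPDFReal, Real.coe_toNNReal _ (by norm_num)]
  congr 3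
  · congr 1; ring
  · ring

/-- Completing the square turns the integrand, density included, into a constant times the density
of N(a / l, 1 / (2 l)). -/
lemma lintegral_exp_gaussianReal_of_pos {l : ℝ} (hl : 0 < l) (a : ℝ) :
    ∫⁻ t, ENNReal.ofReal (Real.exp (2 * (a * t) - (l - 1) * t ^ 2))
      ∂gaussianReal 0 ((1 : ℝ) / 2).toNNReal =
    ENNReal.ofReal ((√l)⁻¹ * Real.exp (a ^ 2 / l)) := by
  rw [gaussianReal_half_eq_withDensity, lintegral_withDensity_eq_lintegral_mul _ (by fun_prop)
    (by fun_prop)]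
  have hv : (1 / (2 * l)).toNNReal ≠ 0 := by simp [hl]
  have h : ∀ t : ℝ, ENNReal.ofReal ((√Real.pi)⁻¹ * Real.exp (-t ^ 2)) *
      ENNReal.ofReal (Real.exp (2 * (a * t) - (l - 1) * t ^ 2)) =
      ENNReal.ofReal ((√l)⁻¹ * Real.exp (a ^ 2 / l)) *
        ENNReal.ofReal (gaussianPDFReal (a / l) (1 / (2 * l)).toNNReal t) := by
    intro t
    rw [← ENNReal.ofReal_mul (by positivity), ← ENNReal.ofReal_mul (by positivity)]
    congr 1
    rw [gaussianPDFReal, Real.coe_toNNReal _ (by positivity)]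
    have e1 : 2 * Real.pi * (1 / (2 * l)) = Real.pi / l := by field_simp
    have e2 : √l ≠ 0 := (Real.sqrt_pos.2 hl).ne'
    have e3 : √Real.pi ≠ 0 := (Real.sqrt_pos.2 Real.pi_pos).ne'
    rw [e1, Real.sqrt_div Real.pi_pos.le]
    have e4 : (√l)⁻¹ * Real.exp (a ^ 2 / l) * ((√Real.pi / √l)⁻¹ *
        Real.exp (-(t - a / l) ^ 2 / (2 * (1 / (2 * l))))) = (√Real.pi)⁻¹ *
        (Real.exp (a ^ 2 / l) * Real.exp (-(t - a / l) ^ 2 / (2 * (1 / (2 * l))))) := by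
      field_simp
    rw [e4, mul_assoc, ← Real.exp_add, ← Real.exp_add]
    congr 2
    field_simp
    ring
  simp only [Pi.mul_apply, h]
  rw [lintegral_const_mul _ (by fun_prop), lintegral_gaussianPDFReal_eq_one _ hv, mul_one]

/-- Including the density, the exponent is 2 a t - l t², which is nonnegative wherever a t ≥ 0. The
integrand thus stays above a positive constant on a set of infinite length. -/
lemma lintegral_exp_gaussianReal_of_nonpos {l : ℝ} (hl : l ≤ 0) (a : ℝ) :
    ∫⁻ t, ENNReal.ofReal (Real.exp (2 * (a * t) - (l - 1) * t ^ 2))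
      ∂gaussianReal 0 ((1 : ℝ) / 2).toNNReal = ⊤ := by
  rw [gaussianReal_half_eq_withDensity, lintegral_withDensity_eq_lintegral_mul _ (by fun_prop)
    (by fun_prop), eq_top_iff]
  have hvol : volume {t : ℝ | 0 ≤ a * t} = ⊤ := by
    rw [eq_top_iff]
    rcases le_total 0 a with h | h
    · rw [← Real.volume_Ici (a := 0)]
      exact measure_mono fun t (ht : 0 ≤ t) => mul_nonneg h ht
    · rw [← Real.volume_Iic (a := 0)]
      exact measure_mono fun t (ht : t ≤ 0) => mul_nonneg_of_nonpos_of_nonpos h ht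
  have hc : ENNReal.ofReal (√Real.pi)⁻¹ ≠ 0 := by
    simp [Real.pi_pos]
  calc (⊤ : ℝ≥0∞) = ENNReal.ofReal (√Real.pi)⁻¹ * volume {t : ℝ | 0 ≤ a * t} := by
        rw [hvol, ENNReal.mul_top hc]
    _ ≤ ENNReal.ofReal (√Real.pi)⁻¹ * volume {t : ℝ | ENNReal.ofReal (√Real.pi)⁻¹ ≤
          ((fun t => ENNReal.ofReal ((√Real.pi)⁻¹ * Real.exp (-t ^ 2))) * fun t =>
            ENNReal.ofReal (Real.exp (2 * (a * t) - (l - 1) * t ^ 2))) t} := by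
        gcongr with t
        intro ht
        rw [Pi.mul_apply, ← ENNReal.ofReal_mul (by positivity)]
        apply ENNReal.ofReal_le_ofReal
        rw [mul_assoc, ← Real.exp_add]
        refine le_mul_of_one_le_right (by positivity) (Real.one_le_exp ?_)
        have := mul_nonneg (neg_nonneg.2 hl) (sq_nonneg t)
        linarith
    _ ≤ _ := mul_meas_ge_le_lintegral (by fun_prop) _

instance (v : ℝ) : IsProbabilityMeasure (complexGaussian v) := by
  unfold complexGaussian
  exact Measure.isProbabilityMeasure_map (by fun_prop)

instance (n : ℕ) (v : ℝ) : IsProbabilityMeasure (complexGaussianVec n v) := by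
  unfold complexGaussianVec
  infer_instance

lemma lintegral_complexGaussian (f : ℂ → ℝ≥0∞) (hf : Measurable f) (v : ℝ) :
    ∫⁻ z, f z ∂complexGaussian v = ∫⁻ p : ℝ × ℝ, f ⟨p.1, p.2⟩
      ∂(gaussianReal 0 (v / 2).toNNReal).prod (gaussianReal 0 (v / 2).toNNReal) := by
  rw [complexGaussian, lintegral_map hf (by fun_prop)]
  rfl

/-- The exponential-quadratic integral against `CN(0, 1)`, where `l - 1` is the coefficient of the
quadratic part. -/
noncomputable def gaussianFactor (l : ℝ) (c : ℂ) : ℝ≥0∞ :=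
  if 0 < l then ENNReal.ofReal (l⁻¹ * Real.exp (‖c‖ ^ 2 / l)) else ⊤

lemma gaussianFactor_ne_zero (l : ℝ) (c : ℂ) : gaussianFactor l c ≠ 0 := by
  unfold gaussianFactor
  split_ifs with h
  · have : 0 < l⁻¹ * Real.exp (‖c‖ ^ 2 / l) := by positivity
    simpa using this
  · simp

lemma lintegral_exp_complexGaussian (l : ℝ) (c : ℂ) :
    ∫⁻ z, ENNReal.ofReal (Real.exp (2 * (star z * c).re - (l - 1) * ‖z‖ ^ 2))
      ∂complexGaussian 1 = gaussianFactor l c := by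
  rw [lintegral_complexGaussian _ (by fun_prop)]
  have h : ∀ p : ℝ × ℝ, ENNReal.ofReal (Real.exp (2 * (star (⟨p.1, p.2⟩ : ℂ) * c).re -
      (l - 1) * ‖(⟨p.1, p.2⟩ : ℂ)‖ ^ 2)) =
      ENNReal.ofReal (Real.exp (2 * (c.re * p.1) - (l - 1) * p.1 ^ 2)) *
      ENNReal.ofReal (Real.exp (2 * (c.im * p.2) - (l - 1) * p.2 ^ 2)) := by
    intro p
    rw [← ENNReal.ofReal_mul (by positivity), ← Real.exp_add, Complex.sq_norm, Complex.normSq_apply]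
    congr 2
    simp only [Complex.star_def, Complex.mul_re, Complex.conj_re, Complex.conj_im]
    ring
  simp only [h]
  rw [lintegral_prod_mul (f := fun t => ENNReal.ofReal (Real.exp (2 * (c.re * t) - (l - 1) * t ^ 2)))
    (g := fun t => ENNReal.ofReal (Real.exp (2 * (c.im * t) - (l - 1) * t ^ 2)))
    (by fun_prop) (by fun_prop), gaussianFactor]
  split_ifs with hl
  · rw [lintegral_exp_gaussianReal_of_pos hl, lintegral_exp_gaussianReal_of_pos hl,
      ← ENNReal.ofReal_mul (by positivity), Complex.sq_norm, Complex.normSq_apply]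
    congr 1
    have : √l * √l = l := Real.mul_self_sqrt hl.le
    rw [mul_mul_mul_comm, ← Real.exp_add, ← mul_inv, this]
    congr 2
    ring
  · push Not at hl
    rw [lintegral_exp_gaussianReal_of_nonpos hl, lintegral_exp_gaussianReal_of_nonpos hl]
    simp

/-! ### Unitary invariance -/

lemma charFunDual_complexGaussian (v : ℝ) (L : StrongDual ℝ ℂ) :
    charFunDual (complexGaussian v) L =
      Complex.exp (-((v / 2).toNNReal * ‖(⟨L 1, L Complex.I⟩ : ℂ)‖ ^ 2 / 2 : ℝ)) := by
  have hL : ∀ p : ℝ × ℝ, L (Complex.measurableEquivRealProd.symm p) = p.1 * L 1 + p.2 * L Complex.I := by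
    intro p
    have : Complex.measurableEquivRealProd.symm p = p.1 • (1 : ℂ) + p.2 • Complex.I := by
      apply Complex.ext <;> simp
    rw [this, map_add, map_smul, map_smul]
    rfl
  rw [charFunDual_apply, complexGaussian, integral_map (by fun_prop) (by fun_prop)]
  have h : ∀ p : ℝ × ℝ, Complex.exp (L (Complex.measurableEquivRealProd.symm p) * Complex.I) =
      Complex.exp (L 1 * p.1 * Complex.I) * Complex.exp (L Complex.I * p.2 * Complex.I) := by
    intro p
    rw [hL, ← Complex.exp_add]
    congr 1
    push_cast
    ring
  simp only [h]
  rw [integral_prod_mul (fun s : ℝ => Complex.exp (L 1 * s * Complex.I))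
    (fun s : ℝ => Complex.exp (L Complex.I * s * Complex.I)), ← charFun_apply_real,
    ← charFun_apply_real, charFun_gaussianReal, charFun_gaussianReal, ← Complex.exp_add]
  congr 1
  rw [Complex.sq_norm, Complex.normSq_apply]
  push_cast
  ring

/-- The complex coefficients of a real-linear functional on `ℂⁿ`. -/
noncomputable def dualCoeff {n : ℕ} (L : StrongDual ℝ (Fin n → ℂ)) (j : Fin n) : ℂ :=
  ⟨L (Pi.single j 1), L (Pi.single j Complex.I)⟩

lemma apply_eq_re_dualCoeff {n : ℕ} (L : StrongDual ℝ (Fin n → ℂ)) (x : Fin n → ℂ) :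
    L x = (star (dualCoeff L) ⬝ᵥ x).re := by
  have hx : x = ∑ j, ((x j).re • (Pi.single j 1 : Fin n → ℂ) +
      (x j).im • (Pi.single j Complex.I : Fin n → ℂ)) := by
    ext k
    rw [Finset.sum_apply, Finset.sum_eq_single k]
    · simp
    · intro j _ hj
      simp [hj.symm]
    · simp
  conv_lhs => rw [hx]
  rw [map_sum, dotProduct, Complex.re_sum]
  refine Finset.sum_congr rfl fun j _ => ?_
  rw [map_add, map_smul, map_smul]
  simp only [dualCoeff, Pi.star_apply, Complex.star_def, Complex.mul_re, Complex.conj_re,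
    Complex.conj_im, smul_eq_mul]
  ring

lemma charFunDual_complexGaussianVec {n : ℕ} (v : ℝ) (L : StrongDual ℝ (Fin n → ℂ)) :
    charFunDual (complexGaussianVec n v) L =
      Complex.exp (-((v / 2).toNNReal * (star (dualCoeff L) ⬝ᵥ dualCoeff L).re / 2 : ℝ)) := by
  rw [complexGaussianVec, charFunDual_pi]
  simp only [charFunDual_complexGaussian]
  rw [← Complex.exp_sum]
  congr 1
  rw [dotProduct, Complex.re_sum, ← Complex.ofReal_neg, Finset.mul_sum, Finset.sum_div,
    ← Finset.sum_neg_distrib, Complex.ofReal_sum]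
  refine Finset.sum_congr rfl fun j _ => ?_
  rw [← Complex.ofReal_neg]
  congr 4
  rw [Complex.sq_norm, Complex.normSq_apply]
  simp only [Pi.star_apply, Complex.star_def, Complex.mul_re, Complex.conj_re,
    Complex.conj_im, dualCoeff, ContinuousLinearMap.comp_apply, ContinuousLinearMap.single_apply]
  ring

/-- The characteristic function depends on a functional only through the norm of its coefficient
vector. Pulling back along U multiplies that vector by Uᴴ, which preserves the norm. -/
lemma map_unitary_complexGaussianVec {n : ℕ} (v : ℝ) {U : Matrix (Fin n) (Fin n) ℂ}
    (hU : U * Uᴴ = 1) :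
    (complexGaussianVec n v).map (fun x => U *ᵥ x) = complexGaussianVec n v := by
  have hm : Measurable fun x : Fin n → ℂ => U *ᵥ x :=
    (Continuous.matrix_mulVec continuous_const continuous_id).measurable
  have : IsProbabilityMeasure ((complexGaussianVec n v).map (fun x => U *ᵥ x)) :=
    Measure.isProbabilityMeasure_map hm.aemeasurable
  apply Measure.ext_of_charFunDual
  ext L
  let T : (Fin n → ℂ) →L[ℝ] (Fin n → ℂ) :=
    LinearMap.toContinuousLinearMap ((Matrix.mulVecLin U).restrictScalars ℝ)
  have hT : ∀ x, T x = U *ᵥ x := fun x => rfl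
  have h1 : charFunDual ((complexGaussianVec n v).map (fun x => U *ᵥ x)) L =
      charFunDual (complexGaussianVec n v) (L.comp T) := by
    rw [charFunDual_apply, charFunDual_apply, integral_map hm.aemeasurable (by fun_prop)]
    rfl
  have h2 : dualCoeff (L.comp T) = Uᴴ *ᵥ dualCoeff L := by
    ext j
    apply Complex.ext
    · simp only [dualCoeff, ContinuousLinearMap.comp_apply, hT, mulVec_single_one]
      rw [apply_eq_re_dualCoeff]
      simp only [dotProduct, mulVec, Complex.re_sum, conjTranspose_apply]
      refine Finset.sum_congr rfl fun i _ => ?_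
      simp [dualCoeff]
      ring
    · simp only [dualCoeff, ContinuousLinearMap.comp_apply, hT, mulVec_single]
      rw [apply_eq_re_dualCoeff]
      simp only [dotProduct, mulVec, Complex.re_sum, Complex.im_sum, conjTranspose_apply]
      refine Finset.sum_congr rfl fun i _ => ?_
      simp [dualCoeff]
      ring
  rw [h1, charFunDual_complexGaussianVec, charFunDual_complexGaussianVec, h2]
  have h3 : star (Uᴴ *ᵥ dualCoeff L) ⬝ᵥ (Uᴴ *ᵥ dualCoeff L) =
      star (dualCoeff L) ⬝ᵥ dualCoeff L := by
    rw [star_mulVec, conjTranspose_conjTranspose, ← dotProduct_mulVec, mulVec_mulVec, hU, one_mulVec]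
  rw [h3]

/-! ### The receiver marginal -/

lemma lintegral_pi_prod {n : ℕ} {μ : Fin n → Measure ℂ} [∀ i, IsProbabilityMeasure (μ i)]
    (f : Fin n → ℂ → ℝ≥0∞) (hf : ∀ i, Measurable (f i)) :
    ∫⁻ x, ∏ i, f i (x i) ∂Measure.pi μ = ∏ i, ∫⁻ z, f i z ∂μ i := by
  rw [lintegral_prod_eq_prod_lintegral_of_indepFun Finset.univ (fun i (x : Fin n → ℂ) => f i (x i))
    (iIndepFun_pi fun i => (hf i).aemeasurable) (fun i => (hf i).comp (measurable_pi_apply i))]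
  exact Finset.prod_congr rfl fun i _ => (measurePreserving_eval μ i).lintegral_comp (hf i)

lemma star_dotProduct_mulVec_eq_sum {n : ℕ} {A : Matrix (Fin n) (Fin n) ℂ} (hA : A.IsHermitian)
    (x : Fin n → ℂ) :
    star ((hA.eigenvectorUnitary : Matrix (Fin n) (Fin n) ℂ) *ᵥ x) ⬝ᵥ
      (A *ᵥ ((hA.eigenvectorUnitary : Matrix (Fin n) (Fin n) ℂ) *ᵥ x)) =
    ((∑ i, hA.eigenvalues i * ‖x i‖ ^ 2 : ℝ) : ℂ) := by
  have h := hA.conjStarAlgAut_star_eigenvectorUnitary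
  rw [Unitary.conjStarAlgAut_star_apply] at h
  rw [star_mulVec, ← dotProduct_mulVec, mulVec_mulVec, mulVec_mulVec, ← star_eq_conjTranspose,
    h, dotProduct]
  push_cast
  refine Finset.sum_congr rfl fun i _ => ?_
  rw [mulVec_diagonal, ← Complex.conj_mul']
  simp only [Pi.star_apply, Complex.star_def, Function.comp_apply]
  change (starRingEnd ℂ) (x i) * ((hA.eigenvalues i : ℂ) * x i) = _
  ring

/-- Unitary invariance permits a change to the eigenbasis of 1 + G, where the integrand is a product
over coordinates. The Gaussian weight supplies the identity, so an eigenvalue l of 1 + G enters with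
quadratic coefficient l - 1. -/
lemma lintegral_exp_complexGaussianVec {n : ℕ} {G : Matrix (Fin n) (Fin n) ℂ}
    (hA : (1 + G).IsHermitian) (c : Fin n → ℂ) :
    ∫⁻ x, ENNReal.ofReal (Real.exp (2 * (star x ⬝ᵥ c).re - (star x ⬝ᵥ (G *ᵥ x)).re))
      ∂complexGaussianVec n 1 =
    ∏ i, gaussianFactor (hA.eigenvalues i)
      (((hA.eigenvectorUnitary : Matrix (Fin n) (Fin n) ℂ)ᴴ *ᵥ c) i) := by
  set U := (hA.eigenvectorUnitary : Matrix (Fin n) (Fin n) ℂ) with hU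
  have hUU : U * Uᴴ = 1 := Unitary.coe_mul_star_self hA.eigenvectorUnitary
  have hUU' : Uᴴ * U = 1 := Unitary.coe_star_mul_self hA.eigenvectorUnitary
  have hm : Measurable fun x : Fin n → ℂ => U *ᵥ x :=
    (Continuous.matrix_mulVec continuous_const continuous_id).measurable
  have hcont : Continuous fun x : Fin n → ℂ =>
      Real.exp (2 * (star x ⬝ᵥ c).re - (star x ⬝ᵥ (G *ᵥ x)).re) := by
    have h1 : Continuous fun x : Fin n → ℂ => star x ⬝ᵥ c := by fun_prop
    have h2 : Continuous fun x : Fin n → ℂ => star x ⬝ᵥ (G *ᵥ x) := by fun_prop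
    fun_prop
  rw [← map_unitary_complexGaussianVec 1 hUU, lintegral_map (by fun_prop) hm]
  have h : ∀ x : Fin n → ℂ, ENNReal.ofReal (Real.exp (2 * (star (U *ᵥ x) ⬝ᵥ c).re -
      (star (U *ᵥ x) ⬝ᵥ (G *ᵥ (U *ᵥ x))).re)) =
      ∏ i, ENNReal.ofReal (Real.exp (2 * (star (x i) * (Uᴴ *ᵥ c) i).re -
        (hA.eigenvalues i - 1) * ‖x i‖ ^ 2)) := by
    intro x
    rw [← ENNReal.ofReal_prod_of_nonneg (fun i _ => by positivity), ← Real.exp_sum]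
    congr 2
    have h1 : star (U *ᵥ x) ⬝ᵥ c = ∑ i, star (x i) * (Uᴴ *ᵥ c) i := by
      rw [star_mulVec, ← dotProduct_mulVec]
      rfl
    have h2 : star (U *ᵥ x) ⬝ᵥ (U *ᵥ x) = ((∑ i, ‖x i‖ ^ 2 : ℝ) : ℂ) := by
      rw [star_mulVec, ← dotProduct_mulVec, mulVec_mulVec, hUU', one_mulVec, dotProduct]
      push_cast
      exact Finset.sum_congr rfl fun i _ => Complex.conj_mul' (x i)
    have h3 := star_dotProduct_mulVec_eq_sum hA x
    rw [← hU, add_mulVec, one_mulVec, dotProduct_add, h2] at h3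
    have h4 : (star (U *ᵥ x) ⬝ᵥ (G *ᵥ (U *ᵥ x))).re =
        ∑ i, (hA.eigenvalues i - 1) * ‖x i‖ ^ 2 := by
      have := congrArg Complex.re h3
      rw [Complex.add_re, Complex.ofReal_re, Complex.ofReal_re] at this
      simp only [sub_mul, one_mul, Finset.sum_sub_distrib]
      linarith
    rw [h1, h4, Complex.re_sum, Finset.mul_sum, Finset.sum_sub_distrib]
  simp only [h]
  rw [complexGaussianVec, lintegral_pi_prod (fun i z => ENNReal.ofReal (Real.exp
    (2 * (star z * (Uᴴ *ᵥ c) i).re - (hA.eigenvalues i - 1) * ‖z‖ ^ 2))) (fun i => by fun_prop)]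
  exact Finset.prod_congr rfl fun i _ => lintegral_exp_complexGaussian _ _

/-- A nonpositive eigenvalue makes one factor infinite, and no other factor is zero. -/
lemma receiverMarginal_eq_top {nR nT : ℕ} (Hr : Matrix (Fin nT) (Fin nR) ℂ)
    {Gr : Matrix (Fin nT) (Fin nT) ℂ} (hGr : Gr.IsHermitian) (h : ¬ (1 + Gr).PosDef)
    (y : Fin nR → ℂ) : receiverMarginal Hr Gr y = ⊤ := by
  have hA : (1 + Gr).IsHermitian := isHermitian_one.add hGr
  rw [hA.posDef_iff_eigenvalues_pos] at h
  push Not at h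
  obtain ⟨i, hi⟩ := h
  rw [receiverMarginal]
  simp only [receiverFun]
  rw [lintegral_exp_complexGaussianVec hA, ← Finset.mul_prod_erase _ _ (Finset.mem_univ i),
    gaussianFactor, if_neg (not_lt.2 hi), ENNReal.top_mul]
  exact Finset.prod_ne_zero_iff.2 fun j _ => gaussianFactor_ne_zero _ _

lemma log_receiverMarginal {nR nT : ℕ} (Hr : Matrix (Fin nT) (Fin nR) ℂ)
    {Gr : Matrix (Fin nT) (Fin nT) ℂ} (h : (1 + Gr).PosDef) (y : Fin nR → ℂ) :
    ENNReal.log (receiverMarginal Hr Gr y) =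
      (((star (Hr *ᵥ y) ⬝ᵥ ((1 + Gr)⁻¹ *ᵥ (Hr *ᵥ y))).re - Real.log (1 + Gr).det.re : ℝ) : EReal) := by
  have hA := h.1
  set c := Hr *ᵥ y with hc
  set U := (hA.eigenvectorUnitary : Matrix (Fin nT) (Fin nT) ℂ) with hU
  have hUU : U * Uᴴ = 1 := Unitary.coe_mul_star_self hA.eigenvectorUnitary
  have hUU' : Uᴴ * U = 1 := Unitary.coe_star_mul_self hA.eigenvectorUnitary
  have hpos := h.eigenvalues_pos
  have h1 : receiverMarginal Hr Gr y = ENNReal.ofReal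
      (∏ i, ((hA.eigenvalues i)⁻¹ * Real.exp (‖(Uᴴ *ᵥ c) i‖ ^ 2 / hA.eigenvalues i))) := by
    rw [receiverMarginal]
    simp only [receiverFun]
    rw [lintegral_exp_complexGaussianVec hA, ENNReal.ofReal_prod_of_nonneg]
    · exact Finset.prod_congr rfl fun i _ => if_pos (hpos i)
    · intro i _
      have := hpos i
      positivity
  have h2 : (1 + Gr).det.re = ∏ i, hA.eigenvalues i := by
    rw [hA.det_eq_prod_eigenvalues]
    exact_mod_cast Complex.ofReal_re _
  have h3 : (1 + Gr)⁻¹ = U * diagonal (fun i => ((hA.eigenvalues i)⁻¹ : ℂ)) * Uᴴ := by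
    apply inv_eq_right_inv
    have := hA.spectral_theorem
    rw [Unitary.conjStarAlgAut_apply] at this
    calc (1 + Gr) * _ = U * diagonal (RCLike.ofReal ∘ hA.eigenvalues) * Uᴴ *
          (U * diagonal (fun i => ((hA.eigenvalues i)⁻¹ : ℂ)) * Uᴴ) := congrArg (· * _) this
      _ = U * (diagonal (RCLike.ofReal ∘ hA.eigenvalues) * (Uᴴ * U) * diagonal (fun i => ((hA.eigenvalues i)⁻¹ : ℂ))) * Uᴴ := by
          simp only [Matrix.mul_assoc]
      _ = 1 := by
          rw [hUU', Matrix.mul_one, diagonal_mul_diagonal]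
          have : (fun i => ((RCLike.ofReal : ℝ → ℂ) ∘ hA.eigenvalues) i *
              ((hA.eigenvalues i)⁻¹ : ℂ)) = fun _ => 1 := by
            ext i
            exact mul_inv_cancel₀ (Complex.ofReal_ne_zero.2 (hpos i).ne')
          rw [this, diagonal_one, Matrix.mul_one, hUU]
  have h4 : (star c ⬝ᵥ ((1 + Gr)⁻¹ *ᵥ c)).re = ∑ i, ‖(Uᴴ *ᵥ c) i‖ ^ 2 / hA.eigenvalues i := by
    have : star c ⬝ᵥ ((1 + Gr)⁻¹ *ᵥ c) =
        ((∑ i, ‖(Uᴴ *ᵥ c) i‖ ^ 2 / hA.eigenvalues i : ℝ) : ℂ) := by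
      rw [h3, ← mulVec_mulVec, ← mulVec_mulVec, dotProduct_mulVec, ← conjTranspose_conjTranspose U,
        ← star_mulVec, conjTranspose_conjTranspose, dotProduct]
      push_cast
      refine Finset.sum_congr rfl fun i _ => ?_
      rw [mulVec_diagonal, ← Complex.conj_mul']
      simp only [Pi.star_apply, Complex.star_def]
      ring
    rw [this, Complex.ofReal_re]
  rw [h1, ENNReal.log_ofReal_of_pos (Finset.prod_pos fun i _ => by have := hpos i; positivity),
    Finset.prod_mul_distrib, Finset.prod_inv_distrib, ← Real.exp_sum, ← h2, ← h4,
    Real.log_mul _ (Real.exp_ne_zero _), Real.log_exp, Real.log_inv]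
  · congr 1; ring
  · rw [h2]
    exact inv_ne_zero (Finset.prod_ne_zero_iff.2 fun i _ => (hpos i).ne')

end ChannelShortening

namespace ChannelShortening

/-! ### Second moments -/

section

variable {v : ℝ}

lemma memLp_id_complexGaussian : MemLp (fun z : ℂ => z) 2 (complexGaussian v) := by
  have h1 : MemLp (fun p : ℝ × ℝ => (p.1 : ℂ)) 2
      ((gaussianReal 0 (v / 2).toNNReal).prod (gaussianReal 0 (v / 2).toNNReal)) :=
    ((memLp_id_gaussianReal 2).comp_measurePreserving measurePreserving_fst).ofReal
  have h2 : MemLp (fun p : ℝ × ℝ => (p.2 : ℂ)) 2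
      ((gaussianReal 0 (v / 2).toNNReal).prod (gaussianReal 0 (v / 2).toNNReal)) :=
    ((memLp_id_gaussianReal 2).comp_measurePreserving measurePreserving_snd).ofReal
  rw [complexGaussian, memLp_map_measure_iff (by fun_prop) (by fun_prop)]
  refine (h1.add (h2.const_mul Complex.I)).congr_norm (by fun_prop) (ae_of_all _ fun p => ?_)
  congr 1
  apply Complex.ext <;> simp

lemma integral_complexGaussian (f : ℂ → ℂ) (hf : Continuous f) :
    ∫ z, f z ∂complexGaussian v = ∫ p : ℝ × ℝ, f ⟨p.1, p.2⟩
      ∂(gaussianReal 0 (v / 2).toNNReal).prod (gaussianReal 0 (v / 2).toNNReal) := by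
  rw [complexGaussian, integral_map (by fun_prop) (by fun_prop)]
  rfl

/-- The law is invariant under z ↦ -z, as its characteristic function is even. -/
lemma integral_id_complexGaussian : ∫ z, z ∂complexGaussian v = 0 := by
  have hint : Integrable (fun z : ℂ => z) (complexGaussian v) :=
    memLp_id_complexGaussian.integrable (by norm_num)
  have hneg : (complexGaussian v).map (fun z => -z) = complexGaussian v := by
    apply Measure.ext_of_charFunDual
    ext L
    have h1 : charFunDual ((complexGaussian v).map fun z => -z) L =
        charFunDual (complexGaussian v) (-L) := by
      rw [charFunDual_apply, charFunDual_apply, integral_map (by fun_prop) (by fun_prop)]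
      simp
    rw [h1, charFunDual_complexGaussian, charFunDual_complexGaussian]
    congr 4
    rw [Complex.sq_norm, Complex.sq_norm, Complex.normSq_apply, Complex.normSq_apply]
    simp
  have h2 : ∫ z, z ∂(complexGaussian v).map (fun z => -z) = -∫ z, z ∂complexGaussian v := by
    rw [integral_map (by fun_prop) (by fun_prop), integral_neg]
  rw [hneg] at h2
  exact self_eq_neg.1 h2

lemma integral_sq_gaussianReal (w : NNReal) : ∫ t, t ^ 2 ∂gaussianReal 0 w = w := by
  have h := variance_eq_integral (μ := gaussianReal 0 w) (X := fun t => t) (by fun_prop)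
  rw [variance_fun_id_gaussianReal, integral_id_gaussianReal] at h
  simpa using h.symm

lemma integral_star_mul_self_complexGaussian (hv : 0 ≤ v) :
    ∫ z, star z * z ∂complexGaussian v = v := by
  rw [integral_complexGaussian _ (by fun_prop)]
  have h : ∀ p : ℝ × ℝ, star (⟨p.1, p.2⟩ : ℂ) * ⟨p.1, p.2⟩ = ((p.1 ^ 2 + p.2 ^ 2 : ℝ) : ℂ) := by
    intro p
    rw [Complex.star_def, Complex.conj_mul', ← Complex.ofReal_pow, Complex.sq_norm,
      Complex.normSq_apply]
    congr 1
    ring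
  simp only [h]
  have hi : Integrable (fun t : ℝ => t ^ 2) (gaussianReal 0 (v / 2).toNNReal) :=
    (memLp_id_gaussianReal 2).integrable_sq
  rw [integral_complex_ofReal, integral_add (hi.comp_fst _) (hi.comp_snd _),
    integral_fun_fst (fun t : ℝ => t ^ 2), integral_fun_snd (fun t : ℝ => t ^ 2),
    integral_sq_gaussianReal, Real.coe_toNNReal _ (by positivity)]
  simp

variable {n : ℕ}

lemma memLp_eval_complexGaussianVec (i : Fin n) :
    MemLp (fun x : Fin n → ℂ => x i) 2 (complexGaussianVec n v) :=
  memLp_id_complexGaussian.comp_measurePreserving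
    (measurePreserving_eval (fun _ : Fin n => complexGaussian v) i)

lemma integrable_eval_complexGaussianVec (i : Fin n) :
    Integrable (fun x : Fin n → ℂ => x i) (complexGaussianVec n v) :=
  (memLp_eval_complexGaussianVec i).integrable (by norm_num)

lemma integral_eval_complexGaussianVec (i : Fin n) :
    ∫ x, x i ∂complexGaussianVec n v = 0 := by
  rw [complexGaussianVec, integral_comp_eval (μ := fun _ : Fin n => complexGaussian v) (f := fun z : ℂ => z) (by fun_prop),
    integral_id_complexGaussian]

lemma integrable_star_mul_complexGaussianVec (i j : Fin n) :
    Integrable (fun x : Fin n → ℂ => star (x i) * x j) (complexGaussianVec n v) :=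
  (memLp_eval_complexGaussianVec i).star.integrable_mul (memLp_eval_complexGaussianVec j)

lemma integral_star_mul_complexGaussianVec (hv : 0 ≤ v) (i j : Fin n) :
    ∫ x, star (x i) * x j ∂complexGaussianVec n v = if i = j then (v : ℂ) else 0 := by
  split_ifs with h
  · subst h
    rw [complexGaussianVec, integral_comp_eval (μ := fun _ : Fin n => complexGaussian v) (f := fun z : ℂ => star z * z) (by fun_prop),
      integral_star_mul_self_complexGaussian hv]
  · have hind : IndepFun (fun x : Fin n → ℂ => x i) (fun x => x j) (complexGaussianVec n v) :=
      (iIndepFun_pi (X := fun _ z => z) (fun i => by fun_prop)).indepFun h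
    have hind' := hind.comp (φ := fun z : ℂ => star z) (ψ := fun z : ℂ => z) (by fun_prop)
      (by fun_prop)
    have := hind'.integral_fun_mul_eq_mul_integral
      (memLp_eval_complexGaussianVec i).star.1 (memLp_eval_complexGaussianVec j).1
    simp only [Function.comp_def] at this
    rw [this, integral_eval_complexGaussianVec, mul_zero]

lemma star_dotProduct_mulVec_eq {m n : ℕ} (M : Matrix (Fin m) (Fin n) ℂ) (x : Fin m → ℂ)
    (y : Fin n → ℂ) : star x ⬝ᵥ (M *ᵥ y) = ∑ i, ∑ j, M i j * (star (x i) * y j) := by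
  simp only [dotProduct, mulVec, Finset.mul_sum]
  refine Finset.sum_congr rfl fun i _ => Finset.sum_congr rfl fun j _ => ?_
  rw [Pi.star_apply]
  ring

lemma integrable_quadratic (M : Matrix (Fin n) (Fin n) ℂ) :
    Integrable (fun x : Fin n → ℂ => star x ⬝ᵥ (M *ᵥ x)) (complexGaussianVec n v) := by
  simp only [star_dotProduct_mulVec_eq]
  exact integrable_finsetSum _ fun i _ => integrable_finsetSum _ fun j _ =>
    (integrable_star_mul_complexGaussianVec i j).const_mul _

lemma integral_quadratic (hv : 0 ≤ v) (M : Matrix (Fin n) (Fin n) ℂ) :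
    ∫ x, star x ⬝ᵥ (M *ᵥ x) ∂complexGaussianVec n v = v * M.trace := by
  simp only [star_dotProduct_mulVec_eq]
  have hi : ∀ i j, Integrable (fun x : Fin n → ℂ => M i j * (star (x i) * x j))
      (complexGaussianVec n v) := fun i j =>
    (integrable_star_mul_complexGaussianVec i j).const_mul _
  rw [integral_finsetSum _ fun i _ => integrable_finsetSum _ fun j _ => hi i j, trace,
    Finset.mul_sum]
  refine Finset.sum_congr rfl fun i _ => ?_
  rw [integral_finsetSum _ fun j _ => hi i j]
  simp only [integral_const_mul, integral_star_mul_complexGaussianVec hv]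
  simp [mul_comm]

end

section

variable {m n : ℕ} {v w : ℝ}

lemma integrable_cross (M : Matrix (Fin m) (Fin n) ℂ) :
    Integrable (fun p : (Fin m → ℂ) × (Fin n → ℂ) => star p.1 ⬝ᵥ (M *ᵥ p.2))
      ((complexGaussianVec m v).prod (complexGaussianVec n w)) := by
  simp only [star_dotProduct_mulVec_eq]
  exact integrable_finsetSum _ fun i _ => integrable_finsetSum _ fun j _ =>
    (((memLp_eval_complexGaussianVec i).star.integrable (by norm_num)).mul_prod
      (integrable_eval_complexGaussianVec j)).const_mul _

lemma integral_cross (M : Matrix (Fin m) (Fin n) ℂ) :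
    ∫ p, star p.1 ⬝ᵥ (M *ᵥ p.2) ∂(complexGaussianVec m v).prod (complexGaussianVec n w) = 0 := by
  simp only [star_dotProduct_mulVec_eq]
  have hi : ∀ i j, Integrable (fun p : (Fin m → ℂ) × (Fin n → ℂ) => M i j * (star (p.1 i) * p.2 j))
      ((complexGaussianVec m v).prod (complexGaussianVec n w)) := fun i j =>
    (((memLp_eval_complexGaussianVec i).star.integrable (by norm_num)).mul_prod
      (integrable_eval_complexGaussianVec j)).const_mul _
  rw [integral_finsetSum _ fun i _ => integrable_finsetSum _ fun j _ => hi i j]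
  refine Finset.sum_eq_zero fun i _ => ?_
  rw [integral_finsetSum _ fun j _ => hi i j]
  refine Finset.sum_eq_zero fun j _ => ?_
  rw [integral_const_mul, integral_prod_mul (fun x : Fin m → ℂ => star (x i)) (fun y : Fin n → ℂ => y j),
    integral_eval_complexGaussianVec, mul_zero, mul_zero]

end

/-! ### Moments of the channel law -/

section

variable {nR nT : ℕ} (H : Matrix (Fin nR) (Fin nT) ℂ) (N₀ : ℝ)

lemma continuous_channel : Continuous fun p : (Fin nT → ℂ) × (Fin nR → ℂ) =>
    (p.1, H *ᵥ p.1 + p.2) := by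
  fun_prop

instance : IsProbabilityMeasure (channelLaw H N₀) := by
  unfold channelLaw
  exact Measure.isProbabilityMeasure_map (continuous_channel H).measurable.aemeasurable

lemma input_output_expand (M : Matrix (Fin nT) (Fin nR) ℂ) (x : Fin nT → ℂ) (w : Fin nR → ℂ) :
    star x ⬝ᵥ (M *ᵥ (H *ᵥ x + w)) = star x ⬝ᵥ ((M * H) *ᵥ x) + star x ⬝ᵥ (M *ᵥ w) := by
  rw [mulVec_add, dotProduct_add, mulVec_mulVec]

/-- The noise-input term is written as the conjugate of an input-noise term, so that
`integral_cross` disposes of both. -/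
lemma output_output_expand (M : Matrix (Fin nR) (Fin nR) ℂ) (x : Fin nT → ℂ) (w : Fin nR → ℂ) :
    star (H *ᵥ x + w) ⬝ᵥ (M *ᵥ (H *ᵥ x + w)) = star x ⬝ᵥ ((Hᴴ * M * H) *ᵥ x) +
      star w ⬝ᵥ (M *ᵥ w) + star x ⬝ᵥ ((Hᴴ * M) *ᵥ w) + star (star x ⬝ᵥ ((Hᴴ * Mᴴ) *ᵥ w)) := by
  have h : star w ⬝ᵥ ((M * H) *ᵥ x) = star (star x ⬝ᵥ ((Hᴴ * Mᴴ) *ᵥ w)) := by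
    rw [← star_dotProduct, star_mulVec, conjTranspose_mul, conjTranspose_conjTranspose,
      conjTranspose_conjTranspose, dotProduct_mulVec]
  rw [← h, star_add, add_dotProduct, mulVec_add, dotProduct_add, dotProduct_add, star_mulVec,
    ← dotProduct_mulVec, ← dotProduct_mulVec]
  simp only [mulVec_mulVec, Matrix.mul_assoc]
  ring

variable {H N₀}

lemma integrable_channel_input (M : Matrix (Fin nT) (Fin nT) ℂ) :
    Integrable (fun p => star p.1 ⬝ᵥ (M *ᵥ p.1)) (channelLaw H N₀) := by
  rw [channelLaw, integrable_map_measure (by fun_prop) (by fun_prop)]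
  exact (integrable_quadratic M).comp_fst _

lemma integral_channel_input (M : Matrix (Fin nT) (Fin nT) ℂ) :
    ∫ p, star p.1 ⬝ᵥ (M *ᵥ p.1) ∂channelLaw H N₀ = M.trace := by
  rw [channelLaw, integral_map (by fun_prop) (by fun_prop),
    integral_fun_fst (fun x : Fin nT → ℂ => star x ⬝ᵥ (M *ᵥ x)), integral_quadratic zero_le_one]
  simp

lemma integrable_channel_cross (M : Matrix (Fin nT) (Fin nR) ℂ) :
    Integrable (fun p => star p.1 ⬝ᵥ (M *ᵥ p.2)) (channelLaw H N₀) := by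
  rw [channelLaw, integrable_map_measure (by fun_prop) (by fun_prop)]
  simp only [Function.comp_def, input_output_expand]
  exact ((integrable_quadratic (M * H)).comp_fst _).add (integrable_cross M)

lemma integral_channel_cross (M : Matrix (Fin nT) (Fin nR) ℂ) :
    ∫ p, star p.1 ⬝ᵥ (M *ᵥ p.2) ∂channelLaw H N₀ = (M * H).trace := by
  rw [channelLaw, integral_map (by fun_prop) (by fun_prop)]
  simp only [input_output_expand]
  rw [integral_add ((integrable_quadratic (M * H)).comp_fst _) (integrable_cross M),
    integral_fun_fst (fun x : Fin nT → ℂ => star x ⬝ᵥ ((M * H) *ᵥ x)),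
    integral_quadratic zero_le_one, integral_cross]
  simp

lemma integrable_channel_output (M : Matrix (Fin nR) (Fin nR) ℂ) :
    Integrable (fun p => star p.2 ⬝ᵥ (M *ᵥ p.2)) (channelLaw H N₀) := by
  rw [channelLaw, integrable_map_measure (by fun_prop) (by fun_prop)]
  simp only [Function.comp_def, output_output_expand]
  exact ((((integrable_quadratic (Hᴴ * M * H)).comp_fst _).add
    ((integrable_quadratic M).comp_snd _)).add (integrable_cross (Hᴴ * M))).add
    (memLp_one_iff_integrable.1 (memLp_one_iff_integrable.2 (integrable_cross (Hᴴ * Mᴴ))).star)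

lemma integral_channel_output (hN₀ : 0 ≤ N₀) (M : Matrix (Fin nR) (Fin nR) ℂ) :
    ∫ p, star p.2 ⬝ᵥ (M *ᵥ p.2) ∂channelLaw H N₀ =
      (M * (H * Hᴴ + (N₀ : ℂ) • (1 : Matrix (Fin nR) (Fin nR) ℂ))).trace := by
  rw [channelLaw, integral_map (by fun_prop) (by fun_prop)]
  simp only [output_output_expand]
  have h1 := (integrable_quadratic (v := 1) (Hᴴ * M * H)).comp_fst (complexGaussianVec nR N₀)
  have h2 := (integrable_quadratic (v := N₀) M).comp_snd (complexGaussianVec nT 1)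
  have h3 := integrable_cross (v := 1) (w := N₀) (Hᴴ * M)
  have h4 : Integrable (fun p : (Fin nT → ℂ) × (Fin nR → ℂ) =>
      star (star p.1 ⬝ᵥ ((Hᴴ * Mᴴ) *ᵥ p.2)))
      ((complexGaussianVec nT 1).prod (complexGaussianVec nR N₀)) := memLp_one_iff_integrable.1
    (memLp_one_iff_integrable.2 (integrable_cross (v := 1) (w := N₀) (Hᴴ * Mᴴ))).star
  have h12 : Integrable (fun p : (Fin nT → ℂ) × (Fin nR → ℂ) => star p.1 ⬝ᵥ ((Hᴴ * M * H) *ᵥ p.1) +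
      star p.2 ⬝ᵥ (M *ᵥ p.2)) ((complexGaussianVec nT 1).prod (complexGaussianVec nR N₀)) :=
    h1.add h2
  have h123 : Integrable (fun p : (Fin nT → ℂ) × (Fin nR → ℂ) => star p.1 ⬝ᵥ ((Hᴴ * M * H) *ᵥ p.1) +
      star p.2 ⬝ᵥ (M *ᵥ p.2) + star p.1 ⬝ᵥ ((Hᴴ * M) *ᵥ p.2))
      ((complexGaussianVec nT 1).prod (complexGaussianVec nR N₀)) := h12.add h3
  have h5 : ∫ p, star (star p.1 ⬝ᵥ ((Hᴴ * Mᴴ) *ᵥ p.2))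
      ∂(complexGaussianVec nT 1).prod (complexGaussianVec nR N₀) = 0 := by
    have := integral_conj (μ := (complexGaussianVec nT 1).prod (complexGaussianVec nR N₀))
      (f := fun p => star p.1 ⬝ᵥ ((Hᴴ * Mᴴ) *ᵥ p.2))
    rw [integral_cross, map_zero] at this
    exact this
  rw [integral_add h123 h4, integral_add h12 h3, integral_add h1 h2,
    integral_fun_fst (fun x : Fin nT → ℂ => star x ⬝ᵥ ((Hᴴ * M * H) *ᵥ x)),
    integral_fun_snd (fun x : Fin nR → ℂ => star x ⬝ᵥ (M *ᵥ x)),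
    integral_quadratic zero_le_one, integral_quadratic hN₀, integral_cross, h5,
    Matrix.mul_add, trace_add, ← Matrix.mul_assoc, trace_mul_comm (M * H), ← Matrix.mul_assoc]
  simp

/-! ### The value of the generalized mutual information -/

lemma extExpectation_coe {Ω : Type*} [MeasurableSpace Ω] {μ : Measure Ω} {f : Ω → ℝ}
    (hf : Integrable f μ) : extExpectation μ (fun ω => (f ω : EReal)) = ((∫ ω, f ω ∂μ : ℝ) : EReal) := by
  have h1 : ∀ r : ℝ, (r : EReal).toENNReal = ENNReal.ofReal r := fun r =>
    EReal.toENNReal_of_ne_top (EReal.coe_ne_top r)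
  have t1 : ∫⁻ ω, ENNReal.ofReal (f ω) ∂μ ≠ ⊤ := hf.lintegral_lt_top.ne
  have t2 : ∫⁻ ω, ENNReal.ofReal (-f ω) ∂μ ≠ ⊤ := hf.neg.lintegral_lt_top.ne
  rw [extExpectation, integral_eq_lintegral_pos_part_sub_lintegral_neg_part hf]
  simp only [← EReal.coe_neg, h1]
  rw [EReal.coe_sub, EReal.coe_ennreal_toReal t1, EReal.coe_ennreal_toReal t2]

lemma extExpectation_top {Ω : Type*} [MeasurableSpace Ω] {μ : Measure Ω} [IsProbabilityMeasure μ] :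
    extExpectation μ (fun _ => (⊤ : EReal)) = ⊤ := by
  simp [extExpectation]

/-- The generalized mutual information in closed form. -/
noncomputable def rate (H : Matrix (Fin nR) (Fin nT) ℂ) (N₀ : ℝ) (Hr : Matrix (Fin nT) (Fin nR) ℂ)
    (Gr : Matrix (Fin nT) (Fin nT) ℂ) : ℝ :=
  Real.log (1 + Gr).det.re -
    (Hrᴴ * (1 + Gr)⁻¹ * Hr * (H * Hᴴ + (N₀ : ℂ) • (1 : Matrix (Fin nR) (Fin nR) ℂ))).trace.re +
    2 * (Hr * H).trace.re - Gr.trace.re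

/-- Both logarithms are integrable quadratic forms plus constants, so the extended expectations are
ordinary integrals given by the channel covariances. -/
lemma gmi_eq_rate (hN₀ : 0 ≤ N₀) (Hr : Matrix (Fin nT) (Fin nR) ℂ)
    {Gr : Matrix (Fin nT) (Fin nT) ℂ} (h : (1 + Gr).PosDef) :
    gmi H N₀ Hr Gr = (rate H N₀ Hr Gr : EReal) := by
  have hq : ∀ y : Fin nR → ℂ, star (Hr *ᵥ y) ⬝ᵥ ((1 + Gr)⁻¹ *ᵥ (Hr *ᵥ y)) =
      star y ⬝ᵥ ((Hrᴴ * (1 + Gr)⁻¹ * Hr) *ᵥ y) := by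
    intro y
    rw [star_mulVec, ← dotProduct_mulVec, mulVec_mulVec, mulVec_mulVec, Matrix.mul_assoc]
  have i1 := (integrable_channel_output (H := H) (N₀ := N₀) (Hrᴴ * (1 + Gr)⁻¹ * Hr)).re
  have i2 := (integrable_channel_cross (H := H) (N₀ := N₀) Hr).re
  have i3 := (integrable_channel_input (H := H) (N₀ := N₀) Gr).re
  simp only [RCLike.re_to_complex] at i1 i2 i3
  have e1 := integral_re (integrable_channel_output (H := H) (N₀ := N₀) (Hrᴴ * (1 + Gr)⁻¹ * Hr))
  have e2 := integral_re (integrable_channel_cross (H := H) (N₀ := N₀) Hr)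
  have e3 := integral_re (integrable_channel_input (H := H) (N₀ := N₀) Gr)
  simp only [RCLike.re_to_complex, integral_channel_output hN₀, integral_channel_cross,
    integral_channel_input] at e1 e2 e3
  have i4 : Integrable (fun p : (Fin nT → ℂ) × (Fin nR → ℂ) =>
      (star p.2 ⬝ᵥ ((Hrᴴ * (1 + Gr)⁻¹ * Hr) *ᵥ p.2)).re - Real.log (1 + Gr).det.re)
      (channelLaw H N₀) := i1.sub (integrable_const _)
  have i5 : Integrable (fun p : (Fin nT → ℂ) × (Fin nR → ℂ) =>
      2 * (star p.1 ⬝ᵥ (Hr *ᵥ p.2)).re - (star p.1 ⬝ᵥ (Gr *ᵥ p.1)).re)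
      (channelLaw H N₀) := (i2.const_mul 2).sub i3
  rw [gmi]
  simp only [log_receiverMarginal Hr h, receiverFun, Real.log_exp, hq]
  rw [extExpectation_coe i4,
    extExpectation_coe i5, integral_sub i1 (integrable_const _),
    integral_sub (i2.const_mul 2) i3, integral_const_mul, e1, e2, e3, ← EReal.coe_neg,
    ← EReal.coe_add, rate]
  congr 1
  simp
  ring

/-- The first term is -⊤ = ⊥, and in `EReal` the sum of ⊥ with anything is ⊥. -/
lemma gmi_eq_bot (Hr : Matrix (Fin nT) (Fin nR) ℂ) {Gr : Matrix (Fin nT) (Fin nT) ℂ}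
    (hGr : Gr.IsHermitian) (h : ¬ (1 + Gr).PosDef) : gmi H N₀ Hr Gr = ⊥ := by
  rw [gmi]
  simp only [receiverMarginal_eq_top Hr hGr h, ENNReal.log_top]
  rw [extExpectation_top]
  simp

end

end ChannelShortening

namespace Matrix

variable {ι : Type*} [Fintype ι] [DecidableEq ι]

/-! ### A log-determinant inequality -/

open scoped MatrixOrder in
lemma PosDef.exists_isUnit_eq_conjTranspose_mul_self {A : Matrix ι ι ℂ} (hA : A.PosDef) :
    ∃ W : Matrix ι ι ℂ, IsUnit W ∧ A = Wᴴ * W := by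
  obtain ⟨W, hW⟩ := CStarAlgebra.nonneg_iff_eq_star_mul_self.mp hA.posSemidef.nonneg
  refine ⟨W, ?_, hW⟩
  have h := (isUnit_iff_isUnit_det _).1 hA.isUnit
  rw [hW, det_mul] at h
  exact (isUnit_iff_isUnit_det _).2 (isUnit_of_mul_isUnit_right h)

lemma PosDef.det_eq_re {A : Matrix ι ι ℂ} (hA : A.PosDef) : A.det = (A.det.re : ℂ) := by
  have := (Complex.lt_def.1 hA.det_pos).2
  exact Complex.ext rfl this.symm

lemma PosDef.det_re_pos {A : Matrix ι ι ℂ} (hA : A.PosDef) : 0 < A.det.re :=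
  (Complex.lt_def.1 hA.det_pos).1

/-- Sum log t + 1 ≤ t over the eigenvalues; equality forces every eigenvalue to be 1. -/
lemma PosDef.log_det_add_card_le_trace {M : Matrix ι ι ℂ} (hM : M.PosDef) :
    Real.log M.det.re + Fintype.card ι ≤ M.trace.re ∧
      (Real.log M.det.re + Fintype.card ι = M.trace.re → M = 1) := by
  have hpos := hM.eigenvalues_pos
  have h1 : M.det.re = ∏ i, hM.1.eigenvalues i := by
    rw [hM.1.det_eq_prod_eigenvalues]
    exact_mod_cast Complex.ofReal_re _
  have h2 : M.trace.re = ∑ i, hM.1.eigenvalues i := by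
    rw [hM.1.trace_eq_sum_eigenvalues]
    exact_mod_cast Complex.ofReal_re _
  have h3 : Real.log M.det.re = ∑ i, Real.log (hM.1.eigenvalues i) := by
    rw [h1, Real.log_prod fun i _ => (hpos i).ne']
  have h4 : Real.log M.det.re + Fintype.card ι = ∑ i, (Real.log (hM.1.eigenvalues i) + 1) := by
    rw [h3, Finset.sum_add_distrib]
    simp
  have h5 : ∀ i ∈ Finset.univ, Real.log (hM.1.eigenvalues i) + 1 ≤ hM.1.eigenvalues i := by
    intro i _
    linarith [Real.log_le_sub_one_of_pos (hpos i)]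
  rw [h4, h2]
  refine ⟨Finset.sum_le_sum h5, fun h => ?_⟩
  rw [Finset.sum_eq_sum_iff_of_le h5] at h
  have h6 : hM.1.eigenvalues = fun _ => 1 := by
    ext i
    by_contra hne
    have := Real.log_lt_sub_one_of_pos (hpos i) hne
    linarith [h i (Finset.mem_univ i)]
  rw [hM.1.spectral_theorem, h6]
  have : (RCLike.ofReal ∘ fun _ : ι => (1 : ℝ)) = fun _ => (1 : ℂ) := by
    ext; simp
  rw [this, diagonal_one, map_one]

/-- Writing S = Wᴴ W, the congruence by W⁻¹ carries S to 1 and A to a matrix with trace tr(S⁻¹ A)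
and determinant det A / det S, which reduces the claim to `PosDef.log_det_add_card_le_trace`. -/
lemma PosDef.log_det_sub_trace_le {S A : Matrix ι ι ℂ} (hS : S.PosDef) (hA : A.PosDef) :
    Real.log A.det.re - (S⁻¹ * A).trace.re ≤ Real.log S.det.re - (S⁻¹ * S).trace.re ∧
      (Real.log A.det.re - (S⁻¹ * A).trace.re = Real.log S.det.re - (S⁻¹ * S).trace.re →
        A = S) := by
  obtain ⟨W, hW, rfl⟩ := hS.exists_isUnit_eq_conjTranspose_mul_self
  have hWd := (isUnit_iff_isUnit_det _).1 hW
  have hWi : IsUnit W⁻¹ := isUnit_nonsing_inv_iff.2 hW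
  have hM : ((W⁻¹)ᴴ * A * W⁻¹).PosDef := hWi.posDef_star_left_conjugate_iff.2 hA
  have hSd := (isUnit_iff_isUnit_det _).1 hS.isUnit
  have htr : ((W⁻¹)ᴴ * A * W⁻¹).trace = ((Wᴴ * W)⁻¹ * A).trace := by
    rw [mul_inv_rev, conjTranspose_nonsing_inv, trace_mul_comm, Matrix.mul_assoc]
  have hback : Wᴴ * ((W⁻¹)ᴴ * A * W⁻¹) * W = A := by
    calc _ = (W⁻¹ * W)ᴴ * A * (W⁻¹ * W) := by
          simp only [conjTranspose_mul, Matrix.mul_assoc]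
      _ = A := by rw [nonsing_inv_mul _ hWd]; simp
  have hdet : A.det.re = ((W⁻¹)ᴴ * A * W⁻¹).det.re * (Wᴴ * W).det.re := by
    have : A.det = ((W⁻¹)ᴴ * A * W⁻¹).det * (Wᴴ * W).det := by
      conv_lhs => rw [← hback]
      rw [det_mul, det_mul, det_mul Wᴴ W]
      ring
    rw [this, hM.det_eq_re, hS.det_eq_re, ← Complex.ofReal_mul]
    simp only [Complex.ofReal_re]
  rw [hdet, Real.log_mul hM.det_re_pos.ne' hS.det_re_pos.ne', nonsing_inv_mul _ hSd, trace_one,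
    Complex.natCast_re, ← htr]
  obtain ⟨h1, h2⟩ := hM.log_det_add_card_le_trace
  refine ⟨by linarith, fun h => ?_⟩
  rw [← hback, h2 (by linarith), Matrix.mul_one]

end Matrix

namespace ChannelShortening

/-! ### The optimal front end -/

section

variable {nR nT : ℕ} {H : Matrix (Fin nR) (Fin nT) ℂ} {N₀ : ℝ}

lemma output_cov_posDef (H : Matrix (Fin nR) (Fin nT) ℂ) (hN₀ : 0 < N₀) :
    (H * Hᴴ + (N₀ : ℂ) • (1 : Matrix (Fin nR) (Fin nR) ℂ)).PosDef :=
  PosDef.posSemidef_add (posSemidef_self_mul_conjTranspose H)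
    (PosDef.one.smul (Complex.zero_lt_real.2 hN₀))

/-- By the matrix inversion lemma, B is the inverse of the positive definite matrix 1 + N₀⁻¹ Hᴴ H.
-/
lemma mmseMatrix_posDef (H : Matrix (Fin nR) (Fin nT) ℂ) (hN₀ : 0 < N₀) :
    (mmseMatrix H N₀).PosDef := by
  set C := H * Hᴴ + (N₀ : ℂ) • (1 : Matrix (Fin nR) (Fin nR) ℂ) with hC
  have hCu := (isUnit_iff_isUnit_det _).1 (output_cov_posDef H hN₀).isUnit
  have hN : (N₀ : ℂ) ≠ 0 := Complex.ofReal_ne_zero.2 hN₀.ne'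
  have hD : (1 + (N₀ : ℂ)⁻¹ • (Hᴴ * H)).PosDef :=
    PosDef.one.add_posSemidef ((posSemidef_conjTranspose_mul_self H).smul
      (inv_nonneg.2 (Complex.zero_le_real.2 hN₀.le)))
  have h1 : H + (N₀ : ℂ)⁻¹ • (H * (Hᴴ * H)) = (N₀ : ℂ)⁻¹ • (C * H) := by
    rw [hC, Matrix.add_mul, smul_add, Matrix.smul_mul, Matrix.one_mul, smul_smul,
      inv_mul_cancel₀ hN, one_smul, Matrix.mul_assoc, add_comm]
  have h2 : mmseMatrix H N₀ * (1 + (N₀ : ℂ)⁻¹ • (Hᴴ * H)) = 1 := by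
    have h3 : Hᴴ * C⁻¹ * H * (1 + (N₀ : ℂ)⁻¹ • (Hᴴ * H)) = (N₀ : ℂ)⁻¹ • (Hᴴ * H) := by
      calc _ = Hᴴ * C⁻¹ * (H + (N₀ : ℂ)⁻¹ • (H * (Hᴴ * H))) := by
            rw [Matrix.mul_add, Matrix.mul_one, Matrix.mul_add, Matrix.mul_smul, Matrix.mul_smul]
            simp only [Matrix.mul_assoc]
        _ = (N₀ : ℂ)⁻¹ • (Hᴴ * (C⁻¹ * C) * H) := by
            rw [h1, Matrix.mul_smul]
            simp only [Matrix.mul_assoc]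
        _ = _ := by rw [nonsing_inv_mul _ hCu, Matrix.mul_one]
    rw [mmseMatrix, ← hC, Matrix.sub_mul, h3, Matrix.one_mul, add_sub_cancel_right]
  rw [← inv_eq_left_inv h2]
  exact hD.inv

/-- Completing the square in Hr. With P the optimal front end, C the output covariance and D = Hr -
P, the relation P C = A Hᴴ makes the terms linear in D cancel. The part free of D combines with tr A
into tr(B A). -/
lemma rate_eq (hN₀ : 0 < N₀) {Gr : Matrix (Fin nT) (Fin nT) ℂ} (hA : (1 + Gr).PosDef)
    (Hr : Matrix (Fin nT) (Fin nR) ℂ) :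
    rate H N₀ Hr Gr = Real.log (1 + Gr).det.re - (mmseMatrix H N₀ * (1 + Gr)).trace.re + nT -
      ((Hr - optHr H N₀ Gr)ᴴ * (1 + Gr)⁻¹ * (Hr - optHr H N₀ Gr) *
        (H * Hᴴ + (N₀ : ℂ) • (1 : Matrix (Fin nR) (Fin nR) ℂ))).trace.re := by
  have hCp := output_cov_posDef H hN₀
  set C := H * Hᴴ + (N₀ : ℂ) • (1 : Matrix (Fin nR) (Fin nR) ℂ) with hC
  have hCu := (isUnit_iff_isUnit_det _).1 hCp.isUnit
  have hGt : Gr.trace.re = (1 + Gr).trace.re - nT := by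
    rw [trace_add, trace_one]; simp
  rw [rate, hGt, mmseMatrix, optHr, ← hC]
  set A := 1 + Gr
  clear_value A C
  have hAu := (isUnit_iff_isUnit_det _).1 hA.isUnit
  set P := A * Hᴴ * C⁻¹ with hP
  obtain ⟨D, rfl⟩ : ∃ D, Hr = D + P := ⟨Hr - P, by abel⟩
  have hPC : P * C = A * Hᴴ := by
    rw [hP, Matrix.mul_assoc, nonsing_inv_mul _ hCu, Matrix.mul_one]
  have hAP : A⁻¹ * (A * Hᴴ) = Hᴴ := by
    rw [← Matrix.mul_assoc, nonsing_inv_mul _ hAu, Matrix.one_mul]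
  have hPA : Pᴴ * A⁻¹ = C⁻¹ * H := by
    rw [hP, conjTranspose_mul, conjTranspose_mul, hCp.inv.1.eq, hA.1.eq, conjTranspose_conjTranspose,
      Matrix.mul_assoc, Matrix.mul_assoc, mul_nonsing_inv _ hAu, Matrix.mul_one]
  have hexp : (D + P)ᴴ * A⁻¹ * (D + P) * C = Dᴴ * A⁻¹ * D * C + (H * D)ᴴ + C⁻¹ * (H * D * C) +
      C⁻¹ * (H * (A * Hᴴ)) := by
    rw [conjTranspose_add, Matrix.add_mul, hPA, Matrix.mul_assoc _ (D + P) C, Matrix.add_mul D P C,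
      hPC, Matrix.add_mul, Matrix.mul_add, Matrix.mul_add, Matrix.mul_assoc Dᴴ A⁻¹ (A * Hᴴ), hAP,
      conjTranspose_mul]
    simp only [Matrix.mul_assoc]
    abel
  have t1 : (C⁻¹ * (H * D * C)).trace = (D * H).trace := by
    rw [trace_mul_comm, Matrix.mul_assoc, mul_nonsing_inv _ hCu, Matrix.mul_one, trace_mul_comm]
  have t2 : (H * D)ᴴ.trace.re = (D * H).trace.re := by
    rw [trace_conjTranspose, trace_mul_comm H D]
    simp
  have t3 : (P * H).trace = (Hᴴ * C⁻¹ * H * A).trace := by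
    rw [hP, trace_mul_comm _ A]
    simp only [Matrix.mul_assoc]
  have t4 : (C⁻¹ * (H * (A * Hᴴ))).trace = (Hᴴ * C⁻¹ * H * A).trace := by
    rw [← Matrix.mul_assoc, ← Matrix.mul_assoc, trace_mul_comm]
    simp only [Matrix.mul_assoc]
  rw [add_sub_cancel_right, hexp]
  simp only [Matrix.add_mul, Matrix.sub_mul, Matrix.one_mul, trace_add, trace_sub, Complex.add_re, Complex.sub_re, t1, t2, t3, t4]
  ring

/-- With A = Vᴴ V and C = Wᴴ W, the trace is the squared Frobenius norm of V D Wᴴ, and V and W are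
invertible. -/
lemma trace_quadratic_nonneg {A : Matrix (Fin nT) (Fin nT) ℂ} {C : Matrix (Fin nR) (Fin nR) ℂ}
    (hA : A.PosDef) (hC : C.PosDef) (D : Matrix (Fin nT) (Fin nR) ℂ) :
    0 ≤ (Dᴴ * A * D * C).trace.re ∧ ((Dᴴ * A * D * C).trace.re = 0 → D = 0) := by
  obtain ⟨V, hV, rfl⟩ := hA.exists_isUnit_eq_conjTranspose_mul_self
  obtain ⟨W, hW, rfl⟩ := hC.exists_isUnit_eq_conjTranspose_mul_self
  have h : (Dᴴ * (Vᴴ * V) * D * (Wᴴ * W)).trace = ((V * D * Wᴴ)ᴴ * (V * D * Wᴴ)).trace := by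
    rw [← Matrix.mul_assoc _ Wᴴ W, trace_mul_comm]
    simp only [conjTranspose_mul, conjTranspose_conjTranspose, Matrix.mul_assoc]
  have hp := (posSemidef_conjTranspose_mul_self (V * D * Wᴴ)).trace_nonneg
  rw [h]
  have hp' := Complex.le_def.1 hp
  refine ⟨hp'.1, fun h0 => ?_⟩
  have h1 : ((V * D * Wᴴ)ᴴ * (V * D * Wᴴ)).trace = 0 := Complex.ext h0 hp'.2.symm
  rw [trace_conjTranspose_mul_self_eq_zero_iff] at h1
  have hVd := (isUnit_iff_isUnit_det _).1 hV
  have hWd : IsUnit (Wᴴ).det := (isUnit_iff_isUnit_det _).1 hW.star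
  calc D = V⁻¹ * (V * D * Wᴴ) * (Wᴴ)⁻¹ := by
        rw [Matrix.mul_assoc, Matrix.mul_assoc (V * D), mul_nonsing_inv _ hWd, Matrix.mul_one,
          ← Matrix.mul_assoc, nonsing_inv_mul _ hVd, Matrix.one_mul]
    _ = 0 := by rw [h1]; simp

lemma rate_le (hN₀ : 0 < N₀) {Gr : Matrix (Fin nT) (Fin nT) ℂ} (hA : (1 + Gr).PosDef)
    (Hr : Matrix (Fin nT) (Fin nR) ℂ) : rate H N₀ Hr Gr ≤ rate H N₀ (optHr H N₀ Gr) Gr ∧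
      (rate H N₀ Hr Gr = rate H N₀ (optHr H N₀ Gr) Gr → Hr = optHr H N₀ Gr) := by
  obtain ⟨h1, h2⟩ := trace_quadratic_nonneg hA.inv (output_cov_posDef H hN₀) (Hr - optHr H N₀ Gr)
  rw [rate_eq hN₀ hA Hr, rate_eq hN₀ hA (optHr H N₀ Gr), sub_self, conjTranspose_zero,
    Matrix.zero_mul, Matrix.zero_mul, Matrix.zero_mul, trace_zero, Complex.zero_re]
  exact ⟨by linarith, fun h => sub_eq_zero.1 (h2 (by linarith))⟩

lemma rate_optHr (hN₀ : 0 < N₀) {Gr : Matrix (Fin nT) (Fin nT) ℂ} (hA : (1 + Gr).PosDef) :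
    rate H N₀ (optHr H N₀ Gr) Gr =
      Real.log (1 + Gr).det.re - (mmseMatrix H N₀ * (1 + Gr)).trace.re + nT := by
  rw [rate_eq hN₀ hA, sub_self]
  simp

end

/-! ### The optimal banded matrix -/

lemma trace_mul_eq_of_isBanded {N K : ℕ} {B R A : Matrix (Fin N) (Fin N) ℂ} (hA : IsBanded K A)
    (h : ∀ k l : Fin N, |(k : ℤ) - (l : ℤ)| ≤ K → R k l = B k l) :
    (B * A).trace = (R * A).trace := by
  simp only [trace, diag_apply, mul_apply]
  refine Finset.sum_congr rfl fun k _ => Finset.sum_congr rfl fun l _ => ?_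
  rcases le_or_gt (|(k : ℤ) - (l : ℤ)|) K with hkl | hkl
  · rw [h k l hkl]
  · rw [hA l k (by rwa [abs_sub_comm]), mul_zero, mul_zero]

lemma isBanded_one {N : ℕ} (K : ℕ) : IsBanded K (1 : Matrix (Fin N) (Fin N) ℂ) := by
  intro k l h
  apply one_apply_ne
  rintro rfl
  simp at h
  omega

lemma IsBanded.add {N K : ℕ} {A B : Matrix (Fin N) (Fin N) ℂ} (hA : IsBanded K A)
    (hB : IsBanded K B) : IsBanded K (A + B) := fun k l h => by
  rw [Matrix.add_apply, hA k l h, hB k l h, add_zero]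

lemma IsBanded.sub {N K : ℕ} {A B : Matrix (Fin N) (Fin N) ℂ} (hA : IsBanded K A)
    (hB : IsBanded K B) : IsBanded K (A - B) := fun k l h => by
  rw [Matrix.sub_apply, hA k l h, hB k l h, sub_zero]

lemma isBandExtension_inv_bandSum {N K : ℕ} (hK : K < N) {B : Matrix (Fin N) (Fin N) ℂ}
    (hB : B.PosDef) : IsBandExtension K B (bandSum K B)⁻¹ where
  isUnit_block _ _ := (hB.principal _).isUnit
  isUnit_overlap _ _ := (hB.principal _).isUnit
  isUnit := isUnit_nonsing_inv_iff.2 (bandSum_posDef hK hB).isUnit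
  inv_eq := nonsing_inv_nonsing_inv _ ((isUnit_iff_isUnit_det _).1 (bandSum_posDef hK hB).isUnit)

end ChannelShortening

theorem theorem1 (nR nT K : ℕ) (hK : K < nT) (H : Matrix (Fin nR) (Fin nT) ℂ)
    (N₀ : ℝ) (hN₀ : 0 < N₀) :
    (∀ Gr : Matrix (Fin nT) (Fin nT) ℂ, Gr.IsHermitian → IsBanded K Gr →
      (∀ Hr : Matrix (Fin nT) (Fin nR) ℂ, gmi H N₀ Hr Gr ≤ gmi H N₀ (optHr H N₀ Gr) Gr) ∧
      ((1 + Gr).PosDef → ∀ Hr : Matrix (Fin nT) (Fin nR) ℂ,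
        gmi H N₀ Hr Gr = gmi H N₀ (optHr H N₀ Gr) Gr → Hr = optHr H N₀ Gr) ∧
      (¬ (1 + Gr).PosDef → ∀ Hr : Matrix (Fin nT) (Fin nR) ℂ, gmi H N₀ Hr Gr = ⊥)) ∧
    (∃ Gopt : Matrix (Fin nT) (Fin nT) ℂ, Gopt.IsHermitian ∧ IsBanded K Gopt ∧
      (∀ Gr : Matrix (Fin nT) (Fin nT) ℂ, Gr.IsHermitian → IsBanded K Gr →
        gmi H N₀ (optHr H N₀ Gr) Gr ≤ gmi H N₀ (optHr H N₀ Gopt) Gopt) ∧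
      (∀ Gr : Matrix (Fin nT) (Fin nT) ℂ, Gr.IsHermitian → IsBanded K Gr →
        gmi H N₀ (optHr H N₀ Gr) Gr = gmi H N₀ (optHr H N₀ Gopt) Gopt → Gr = Gopt) ∧
      IsUnit (1 + Gopt) ∧
      IsBandExtension K (mmseMatrix H N₀) (1 + Gopt)⁻¹ ∧
      1 + Gopt =
        (∑ n ∈ Finset.Icc 1 (nT - K),
          placeBlock n (n + K) (principalBlock (mmseMatrix H N₀) n (n + K))⁻¹) -
        (∑ n ∈ Finset.Icc 2 (nT - K),
          placeBlock n (n + K - 1) (principalBlock (mmseMatrix H N₀) n (n + K - 1))⁻¹)) := by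
  constructor
  · intro Gr hGr _
    refine ⟨fun Hr => ?_, fun hA Hr h => ?_, fun hA Hr => gmi_eq_bot Hr hGr hA⟩
    · by_cases hA : (1 + Gr).PosDef
      · rw [gmi_eq_rate hN₀.le _ hA, gmi_eq_rate hN₀.le _ hA, EReal.coe_le_coe_iff]
        exact (rate_le hN₀ hA Hr).1
      · rw [gmi_eq_bot Hr hGr hA]
        exact bot_le
    · rw [gmi_eq_rate hN₀.le _ hA, gmi_eq_rate hN₀.le _ hA, EReal.coe_eq_coe_iff] at h
      exact (rate_le hN₀ hA Hr).2 h
  · have hB := mmseMatrix_posDef H hN₀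
    set S := bandSum K (mmseMatrix H N₀) with hS
    have hSp : S.PosDef := bandSum_posDef hK hB
    have hSb : IsBanded K S := bandSum_isBanded hK hB
    have hS1 : 1 + (S - 1) = S := by abel
    have hopt : (1 + (S - 1)).PosDef := by rwa [hS1]
    -- Trading B for S⁻¹ turns the objective into log det A - tr(S⁻¹ A), whose maximizer S among all
    -- positive definite matrices happens to be banded.
    have htr : ∀ A, IsBanded K A → (mmseMatrix H N₀ * A).trace = (S⁻¹ * A).trace := fun A hA =>
      trace_mul_eq_of_isBanded hA fun k l hkl => inv_bandSum_apply hK hB hkl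
    refine ⟨S - 1, hSp.1.sub isHermitian_one, hSb.sub (isBanded_one K), fun Gr hGr hb => ?_,
      fun Gr hGr hb h => ?_, hopt.isUnit,
      by rw [hS1]; exact isBandExtension_inv_bandSum hK hB, hS1⟩
    · by_cases hA : (1 + Gr).PosDef
      · rw [gmi_eq_rate hN₀.le _ hA, gmi_eq_rate hN₀.le _ hopt, EReal.coe_le_coe_iff,
          rate_optHr hN₀ hA, rate_optHr hN₀ hopt, hS1, htr S hSb,
          htr _ ((isBanded_one K).add hb)]
        linarith [(hSp.log_det_sub_trace_le hA).1]
      · rw [gmi_eq_bot _ hGr hA]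
        exact bot_le
    -- A competitor attaining the maximum has a finite value, which rules out the ⊥ case.
    · have hA : (1 + Gr).PosDef := by
        by_contra hA
        rw [gmi_eq_bot _ hGr hA, gmi_eq_rate hN₀.le _ hopt] at h
        exact EReal.bot_ne_coe _ h
      rw [gmi_eq_rate hN₀.le _ hA, gmi_eq_rate hN₀.le _ hopt, EReal.coe_eq_coe_iff,
        rate_optHr hN₀ hA, rate_optHr hN₀ hopt, hS1, htr S hSb,
        htr _ ((isBanded_one K).add hb)] at h
      rw [← (hSp.log_det_sub_trace_le hA).2 (by linarith)]
      abel
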